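/- Let $\Bbbk$ be an algebraically closed field of characteristic zero, let $U$ be a unipotent algebraic group over $\Bbbk$ with Lie algebra $\mathfrak u$, and let $\lambda:\mathbb G_m\to\mathrm{Aut}(U)$ be a one-parameter subgroup acting on $\mathfrak u$ with a single weight $w_1$, where $w_1>0$. Put $\hat U=U\rtimes_\lambda\mathbb G_m$, where $\mathbb G_m$ acts on $U$ through $\lambda$. Let $Y=\mathrm{Spec}(A)$ be an affine scheme of finite type over $\Bbbk$ with an action of $\hat U$. For $w\in\mathbb Z$ let $A_{\lambda=w}\subseteq A$ be the set of $a\in A$ whose image under the coaction $A\to\Bbbk[t,t^{-1}]\otimes_{\Bbbk} A$ of $\mathbb G_m\subseteq\hat U$ is $t^{-w}\otimes a$. Let $\phi:\Omega_{A/\Bbbk}\to\mathfrak u^*\otimes_{\Bbbk}A$ be the infinitesimal action of $\mathfrak u$, that is, the $A$-linear map $a\,\mathrm db\mapsto\sum_i u_i\otimes a(\xi_i.b)$, where $(\xi_i)$ is a basis of $\mathfrak u$, $(u_i)$ is the dual basis of $\mathfrak u^*$, and $\xi.b:=-(\xi\otimes 1)(\sigma^*b)$ for $\xi\in\mathfrak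 u$, viewed as a point derivation of $\mathcal O(U)$ at the identity, with $\sigma^*:A\to\mathcal O(U)\otimes_{\Bbbk}A$ the coaction of $U$. Let $A^U=\{a\in A:\sigma^*(a)=1\otimes a\}$ be the ring of invariants. Assume that * $A=\bigoplus_{w\in\mathbb Z_{\le0}}A_{\lambda=w}$; * there is a surjective linear map $\mathfrak u\to\mathfrak s$ of $\Bbbk$-vector spaces such that the composition $\mathfrak s^*\otimes_{\Bbbk}A\to\mathfrak u^*\otimes_{\Bbbk}A\to\mathrm{coker}(\phi)$ is an isomorphism. Then: 1. $A^U$ is of finite type over $\Bbbk$, so $Y/U:=\mathrm{Spec}(A^U)$ is an affine scheme of finite type over $\Bbbk$. 2. The morphism $Y\to Y/U$ is a universal geometric quotient by $U$: for every morphism of schemes $Z'\to Y/U$, the base change $\pi:X'=Y\times_{Y/U}Z'\to Z'$, with the induced action of $U$ on $X'$, is affine, surjective and $U$-invariant; $\mathcal O_{Z'}\to\pi_*\mathcal O_{X'}$ is an isomorphism onto the subsheaf of $U$-invariant functions; $\pi$ maps $U$-invariant closed subsets to closed subsets and disjoint $U$-invariant closed subsets to disjoint subsets; and its geometric fibres are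 single orbits, in the sense that $U\times X'\to X'\times_{Z'}X'$, $(u,x)\mapsto(ux,x)$, is surjective. 3. With $m=\dim\mathfrak u-\dim\mathfrak s$, there is an isomorphism of $A^U$-algebras $A\cong A^U[x_1,\dots,x_m]$ with a polynomial ring; equivalently, $Y\cong\mathbb A^m\times Y/U$ over $Y/U$. 4. There is an injective $A$-linear map $\Omega_{A/A^U}\to\mathfrak u^*\otimes_{\Bbbk}A$ whose composition with the canonical map $\Omega_{A/\Bbbk}\to\Omega_{A/A^U}$ is $\phi$. -/

import Mathlib

open scoped TensorProduct LaurentPolynomial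
open CategoryTheory CategoryTheory.Limits AlgebraicGeometry

universe u v

noncomputable section

namespace UHat

/-! ### Actions of affine groups on affine schemes

An affine monoid scheme `G = Spec B` over `k` is given by its comultiplication `Δ` and counit `ε`.
A left action of `G` on `Spec A` is a coaction `A → B ⊗ A`, `a ↦ ((g, y) ↦ a (g · y))`. -/

section Coaction

variable {k B C A : Type u} [Field k] [CommRing B] [Algebra k B] [CommRing C] [Algebra k C]
  [CommRing A] [Algebra k A]

/-- A left action of the affine monoid scheme `(Spec B, Δ, ε)` on `Spec A`. -/
structure Coaction (Δ : B →ₐ[k] B ⊗[k] B) (ε : B →ₐ[k] k) (A : Type u) [CommRing A]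
    [Algebra k A] where
  /-- The comorphism of the action morphism `G × Y → Y`. -/
  hom : A →ₐ[k] B ⊗[k] A
  /-- `(g g') · y = g · (g' · y)`. -/
  coassoc : (Algebra.TensorProduct.assoc k k k B B A).toAlgHom.comp
      ((Algebra.TensorProduct.map Δ (AlgHom.id k A)).comp hom) =
    (Algebra.TensorProduct.map (AlgHom.id k B) hom).comp hom
  /-- `e · y = y`. -/
  counit : (Algebra.TensorProduct.lid k A).toAlgHom.comp
      ((Algebra.TensorProduct.map ε (AlgHom.id k A)).comp hom) = AlgHom.id k A

/-- Restriction of an action along a homomorphism of monoid schemes `Spec C → Spec B`. -/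
def Coaction.restrict {Δ : B →ₐ[k] B ⊗[k] B} {ε : B →ₐ[k] k} (ρ : Coaction Δ ε A)
    {Δ' : C →ₐ[k] C ⊗[k] C} {ε' : C →ₐ[k] k} (p : B →ₐ[k] C)
    (hΔ : (Algebra.TensorProduct.map p p).comp Δ = Δ'.comp p) (hε : ε'.comp p = ε) :
    Coaction Δ' ε' A where
  hom := (Algebra.TensorProduct.map p (AlgHom.id k A)).comp ρ.hom
  coassoc := by
    have h1 : ((Algebra.TensorProduct.map Δ' (AlgHom.id k A)).comp
        (Algebra.TensorProduct.map p (AlgHom.id k A))) =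
        (Algebra.TensorProduct.map (Algebra.TensorProduct.map p p) (AlgHom.id k A)).comp
          (Algebra.TensorProduct.map Δ (AlgHom.id k A)) := by
      rw [← Algebra.TensorProduct.map_comp, ← Algebra.TensorProduct.map_comp, hΔ]
    have h2 : (Algebra.TensorProduct.assoc k k k C C A).toAlgHom.comp
        (Algebra.TensorProduct.map (Algebra.TensorProduct.map p p) (AlgHom.id k A)) =
        (Algebra.TensorProduct.map p (Algebra.TensorProduct.map p (AlgHom.id k A))).comp
          (Algebra.TensorProduct.assoc k k k B B A).toAlgHom := by
      apply Algebra.TensorProduct.ext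
      · apply Algebra.TensorProduct.ext <;> ext x <;>
          simp
      · ext x; simp [Algebra.TensorProduct.one_def]
    have h3 := ρ.coassoc
    calc _ = (Algebra.TensorProduct.assoc k k k C C A).toAlgHom.comp
          (((Algebra.TensorProduct.map Δ' (AlgHom.id k A)).comp
            (Algebra.TensorProduct.map p (AlgHom.id k A))).comp ρ.hom) := rfl
      _ = ((Algebra.TensorProduct.assoc k k k C C A).toAlgHom.comp
          (Algebra.TensorProduct.map (Algebra.TensorProduct.map p p) (AlgHom.id k A))).comp
          ((Algebra.TensorProduct.map Δ (AlgHom.id k A)).comp ρ.hom) := by rw [h1]; rfl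
      _ = (Algebra.TensorProduct.map p (Algebra.TensorProduct.map p (AlgHom.id k A))).comp
          ((Algebra.TensorProduct.assoc k k k B B A).toAlgHom.comp
          ((Algebra.TensorProduct.map Δ (AlgHom.id k A)).comp ρ.hom)) := by rw [h2]; rfl
      _ = ((Algebra.TensorProduct.map p (Algebra.TensorProduct.map p (AlgHom.id k A))).comp
          (Algebra.TensorProduct.map (AlgHom.id k B) ρ.hom)).comp ρ.hom := by rw [h3]; rfl
      _ = ((Algebra.TensorProduct.map (AlgHom.id k C)
          ((Algebra.TensorProduct.map p (AlgHom.id k A)).comp ρ.hom)).comp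
          (Algebra.TensorProduct.map p (AlgHom.id k A))).comp ρ.hom := by
        rw [← Algebra.TensorProduct.map_comp, ← Algebra.TensorProduct.map_comp]; rfl
  counit := by
    rw [← AlgHom.comp_assoc (Algebra.TensorProduct.map ε' _), ← Algebra.TensorProduct.map_comp, hε]
    exact ρ.counit

end Coaction

/-! ### The unipotent group `U = Spec H`, its Lie algebra and its gradings -/

section Group

variable (k H : Type u) [Field k] [CommRing H] [HopfAlgebra k H]

/-- `U = Spec H` is unipotent: it is isomorphic to a closed subgroup of a group of upper
unitriangular matrices, that is, there is an upper unitriangular matrix of functions on `U`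
which is multiplicative in `U` and whose entries generate `H = 𝒪(U)`. -/
def IsUnipotent : Prop :=
  ∃ (n : ℕ) (c : Matrix (Fin n) (Fin n) H),
    (∀ i, c i i = 1) ∧ (∀ i j, j < i → c i j = 0) ∧
    (∀ i j, Coalgebra.comul (R := k) (c i j) = ∑ l, c i l ⊗ₜ[k] c l j) ∧
    Algebra.adjoin k (Set.range fun p : Fin n × Fin n => c p.1 p.2) = ⊤

/-- The point derivations `𝒪(U) → k` at the identity, as a subspace of the dual of `𝒪(U)`. -/
def pointDerivations : Submodule k (Module.Dual k H) where
  carrier := {ξ | ∀ a b : H, ξ (a * b) =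
    Coalgebra.counit (R := k) a * ξ b + Coalgebra.counit (R := k) b * ξ a}
  zero_mem' := by simp
  add_mem' := by
    intro ξ η hξ hη a b
    rw [LinearMap.add_apply, hξ, hη, LinearMap.add_apply, LinearMap.add_apply]
    ring
  smul_mem' := by
    intro c ξ hξ a b
    rw [LinearMap.smul_apply, hξ, LinearMap.smul_apply, LinearMap.smul_apply]
    simp only [smul_eq_mul]
    ring

/-- The vector space `𝔲 = Lie U` of point derivations of `𝒪(U)` at the identity. -/
def lie : Type u := pointDerivations k H

instance : AddCommGroup (lie k H) := inferInstanceAs (AddCommGroup (pointDerivations k H))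

instance : Module k (lie k H) := inferInstanceAs (Module k (pointDerivations k H))

variable {k H} in
/-- The functional `𝒪(U) → k` given by an element of `𝔲`. -/
def lie.toDual : lie k H →ₗ[k] Module.Dual k H := (pointDerivations k H).subtype

variable {k H} in
lemma lie.toDual_mul (ξ : lie k H) (a b : H) : ξ.toDual (a * b) =
    Coalgebra.counit (R := k) a * ξ.toDual b + Coalgebra.counit (R := k) b * ξ.toDual a :=
  ξ.2 a b

variable {k H} in
lemma lie.toDual_one (ξ : lie k H) : ξ.toDual 1 = 0 := by
  have h := ξ.toDual_mul 1 1
  simpa using h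

instance finite_lie [Algebra.FiniteType k H] : Module.Finite k (lie k H) := by
  obtain ⟨s, hs⟩ := (inferInstance : Algebra.FiniteType k H).out
  let f : lie k H →ₗ[k] (s → k) :=
    LinearMap.pi fun a => (LinearMap.applyₗ (a : H)).comp lie.toDual
  refine Module.Finite.of_injective f ?_
  rw [← LinearMap.ker_eq_bot, LinearMap.ker_eq_bot']
  intro ξ hξ
  apply Subtype.ext
  apply LinearMap.ext
  intro a
  have ha : a ∈ Algebra.adjoin k (s : Set H) := by rw [hs]; trivial
  change ξ.toDual a = 0
  induction ha using Algebra.adjoin_induction with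
  | mem x hx => exact congrFun hξ ⟨x, hx⟩
  | algebraMap r => rw [Algebra.algebraMap_eq_smul_one, map_smul, lie.toDual_one, smul_zero]
  | add x y _ _ hx hy => rw [map_add, hx, hy, add_zero]
  | mul x y _ _ hx hy => rw [lie.toDual_mul, hx, hy, mul_zero, mul_zero, add_zero]

/-- A one-parameter subgroup `λ : 𝔾ₘ → Aut(U)`: an action of `𝔾ₘ = Spec k[T;T⁻¹]` on the scheme
`U = Spec H` by group automorphisms. -/
structure OnePS extends
    Coaction (Bialgebra.comulAlgHom k k[T;T⁻¹]) (Bialgebra.counitAlgHom k k[T;T⁻¹]) H where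
  /-- `λ(t)(u u') = λ(t)(u) λ(t)(u')`. -/
  map_mul : (Algebra.TensorProduct.map (AlgHom.id k k[T;T⁻¹]) (Bialgebra.comulAlgHom k H)).comp
      hom =
    ((Algebra.TensorProduct.map (Algebra.TensorProduct.lmul' k (S := k[T;T⁻¹]))
        (AlgHom.id k (H ⊗[k] H))).comp
      (Algebra.TensorProduct.tensorTensorTensorComm k k k k k[T;T⁻¹] H k[T;T⁻¹] H).toAlgHom).comp
    ((Algebra.TensorProduct.map hom hom).comp (Bialgebra.comulAlgHom k H))
  /-- `λ(t)(e) = e`. -/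
  map_one : (Algebra.TensorProduct.map (AlgHom.id k k[T;T⁻¹]) (Bialgebra.counitAlgHom k H)).comp
      hom = Algebra.TensorProduct.includeLeft.comp
        ((Algebra.ofId k k[T;T⁻¹]).comp (Bialgebra.counitAlgHom k H))

variable {k H}

/-- `λ` acts on `𝔲` with the single weight `w`: `λ(t) · ξ = t ^ w ξ` for all `ξ ∈ 𝔲`, where
`(λ(t) · ξ)(h) = ξ (u ↦ h (λ(t)(u)))`. -/
def OnePS.HasSingleWeight (lam : OnePS k H) (w : ℤ) : Prop :=
  ∀ (ξ : lie k H) (h : H),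
    TensorProduct.rid k k[T;T⁻¹] (LinearMap.lTensor k[T;T⁻¹] ξ.toDual (lam.hom h)) =
      ξ.toDual h • (LaurentPolynomial.T w : k[T;T⁻¹])

/-! ### The semi-direct product `Û = U ⋊ 𝔾ₘ` -/

/-- The comultiplication of `𝒪(Û) = 𝒪(U) ⊗ k[T;T⁻¹]`, dual to the multiplication
`(u, t) (u', t') = (u λ(t)(u'), t t')`. -/
def OnePS.comul (lam : OnePS k H) :
    H ⊗[k] k[T;T⁻¹] →ₐ[k] (H ⊗[k] k[T;T⁻¹]) ⊗[k] (H ⊗[k] k[T;T⁻¹]) :=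
  Algebra.TensorProduct.lift
    ((Algebra.TensorProduct.map (AlgHom.id k (H ⊗[k] k[T;T⁻¹]))
        Algebra.TensorProduct.includeLeft).comp
      ((Algebra.TensorProduct.assoc k k k H k[T;T⁻¹] H).symm.toAlgHom.comp
        ((Algebra.TensorProduct.map (AlgHom.id k H) lam.hom).comp (Bialgebra.comulAlgHom k H))))
    ((Algebra.TensorProduct.map Algebra.TensorProduct.includeRight
        Algebra.TensorProduct.includeRight).comp (Bialgebra.comulAlgHom k k[T;T⁻¹]))
    (fun _ _ =>
      let _ : CommSemiring ((H ⊗[k] k[T;T⁻¹]) ⊗[k] (H ⊗[k] k[T;T⁻¹])) := inferInstance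
      Commute.all (S := (H ⊗[k] k[T;T⁻¹]) ⊗[k] (H ⊗[k] k[T;T⁻¹])) _ _)

variable (k H) in
/-- The restriction `𝒪(Û) → 𝒪(U)`, dual to `u ↦ (u, 1)`. -/
def toU : H ⊗[k] k[T;T⁻¹] →ₐ[k] H :=
  (Algebra.TensorProduct.rid k k H).toAlgHom.comp
    (Algebra.TensorProduct.map (AlgHom.id k H) (Bialgebra.counitAlgHom k k[T;T⁻¹]))

variable (k H) in
/-- The restriction `𝒪(Û) → 𝒪(𝔾ₘ)`, dual to `t ↦ (e, t)`. -/
def toGm : H ⊗[k] k[T;T⁻¹] →ₐ[k] k[T;T⁻¹] :=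
  (Algebra.TensorProduct.lid k k[T;T⁻¹]).toAlgHom.comp
    (Algebra.TensorProduct.map (Bialgebra.counitAlgHom k H) (AlgHom.id k k[T;T⁻¹]))

variable (k H) in
/-- The counit of `𝒪(Û)`: evaluation at `(e, 1)`. -/
def counit : H ⊗[k] k[T;T⁻¹] →ₐ[k] k :=
  (Bialgebra.counitAlgHom k H).comp (toU k H)

lemma counit_comp_toGm :
    (Bialgebra.counitAlgHom k k[T;T⁻¹]).comp (toGm k H) = counit k H := by
  ext <;> simp [toGm, toU, counit]

lemma OnePS.comul_comp_includeLeft (lam : OnePS k H) :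
    lam.comul.comp Algebra.TensorProduct.includeLeft =
      ((Algebra.TensorProduct.map (AlgHom.id k (H ⊗[k] k[T;T⁻¹]))
        Algebra.TensorProduct.includeLeft).comp
      ((Algebra.TensorProduct.assoc k k k H k[T;T⁻¹] H).symm.toAlgHom.comp
        ((Algebra.TensorProduct.map (AlgHom.id k H) lam.hom).comp
          (Bialgebra.comulAlgHom k H)))) :=
  Algebra.TensorProduct.lift_comp_includeLeft _ _ _

lemma toU_comul (lam : OnePS k H) :
    (Algebra.TensorProduct.map (toU k H) (toU k H)).comp lam.comul =
      (Bialgebra.comulAlgHom k H).comp (toU k H) := by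
  apply Algebra.TensorProduct.ext
  · have key : ((Algebra.TensorProduct.map (toU k H) (toU k H)).comp
        ((Algebra.TensorProduct.map (AlgHom.id k (H ⊗[k] k[T;T⁻¹]))
          Algebra.TensorProduct.includeLeft).comp
            (Algebra.TensorProduct.assoc k k k H k[T;T⁻¹] H).symm.toAlgHom)) =
        (Algebra.TensorProduct.map (AlgHom.id k H)
          ((Algebra.TensorProduct.lid k H).toAlgHom.comp
            (Algebra.TensorProduct.map (Bialgebra.counitAlgHom k k[T;T⁻¹]) (AlgHom.id k H)))) := by
      apply Algebra.TensorProduct.ext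
      · ext x
        simp [toU, Algebra.TensorProduct.one_def]
      · apply Algebra.TensorProduct.ext <;> ext x <;> simp [toU]
    have h2 : (toU k H).comp Algebra.TensorProduct.includeLeft = AlgHom.id k H := by
      ext x
      simp [toU]
    calc _ = (Algebra.TensorProduct.map (toU k H) (toU k H)).comp
          (lam.comul.comp Algebra.TensorProduct.includeLeft) := rfl
      _ = ((Algebra.TensorProduct.map (toU k H) (toU k H)).comp
        ((Algebra.TensorProduct.map (AlgHom.id k (H ⊗[k] k[T;T⁻¹]))
          Algebra.TensorProduct.includeLeft).comp
            (Algebra.TensorProduct.assoc k k k H k[T;T⁻¹] H).symm.toAlgHom)).comp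
            ((Algebra.TensorProduct.map (AlgHom.id k H) lam.hom).comp
              (Bialgebra.comulAlgHom k H)) := by rw [lam.comul_comp_includeLeft]; rfl
      _ = ((Algebra.TensorProduct.map (AlgHom.id k H)
          ((Algebra.TensorProduct.lid k H).toAlgHom.comp
            (Algebra.TensorProduct.map (Bialgebra.counitAlgHom k k[T;T⁻¹])
              (AlgHom.id k H)))).comp (Algebra.TensorProduct.map (AlgHom.id k H) lam.hom)).comp
              (Bialgebra.comulAlgHom k H) := by rw [key]; rfl
      _ = (Bialgebra.comulAlgHom k H).comp
          ((toU k H).comp Algebra.TensorProduct.includeLeft) := by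
        rw [← Algebra.TensorProduct.map_comp, AlgHom.comp_assoc, lam.counit, h2]
        simp
      _ = _ := rfl
  · ext x
    simp [OnePS.comul, toU, Algebra.TensorProduct.one_def]

lemma toGm_comul (lam : OnePS k H) :
    (Algebra.TensorProduct.map (toGm k H) (toGm k H)).comp lam.comul =
      (Bialgebra.comulAlgHom k k[T;T⁻¹]).comp (toGm k H) := by
  apply Algebra.TensorProduct.ext
  · have key : ((Algebra.TensorProduct.map (toGm k H) (toGm k H)).comp
        ((Algebra.TensorProduct.map (AlgHom.id k (H ⊗[k] k[T;T⁻¹]))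
          Algebra.TensorProduct.includeLeft).comp
            (Algebra.TensorProduct.assoc k k k H k[T;T⁻¹] H).symm.toAlgHom)) =
        (Algebra.TensorProduct.includeLeft.comp
          ((Algebra.TensorProduct.lid k k[T;T⁻¹]).toAlgHom.comp
            ((Algebra.TensorProduct.map (AlgHom.id k k)
              (Algebra.TensorProduct.rid k k k[T;T⁻¹]).toAlgHom).comp
            (Algebra.TensorProduct.map (Bialgebra.counitAlgHom k H)
              (Algebra.TensorProduct.map (AlgHom.id k k[T;T⁻¹])
                (Bialgebra.counitAlgHom k H)))))) := by
      apply Algebra.TensorProduct.ext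
      · ext x
        simp [toGm, Algebra.TensorProduct.one_def, TensorProduct.smul_tmul']
      · apply Algebra.TensorProduct.ext <;> ext x <;>
          simp [toGm, TensorProduct.smul_tmul']
    have h2 : (toGm k H).comp Algebra.TensorProduct.includeLeft =
        (Algebra.ofId k k[T;T⁻¹]).comp (Bialgebra.counitAlgHom k H) := by
      ext x
      simp [toGm, Algebra.ofId_apply, Algebra.algebraMap_eq_smul_one]
    have h3 : (Algebra.TensorProduct.map (Bialgebra.counitAlgHom k H)
          (Algebra.TensorProduct.map (AlgHom.id k k[T;T⁻¹]) (Bialgebra.counitAlgHom k H))).comp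
          (Algebra.TensorProduct.map (AlgHom.id k H) lam.hom) =
        (Algebra.TensorProduct.map (AlgHom.id k k)
          (Algebra.TensorProduct.includeLeft.comp (Algebra.ofId k k[T;T⁻¹]))).comp
        (Algebra.TensorProduct.map (Bialgebra.counitAlgHom k H) (Bialgebra.counitAlgHom k H)) := by
      rw [← Algebra.TensorProduct.map_comp, ← Algebra.TensorProduct.map_comp, lam.map_one]
      rfl
    have h4 : (Algebra.TensorProduct.map (Bialgebra.counitAlgHom k H)
        (Bialgebra.counitAlgHom k H)).comp (Bialgebra.comulAlgHom k H) =
        Algebra.TensorProduct.includeLeft.comp (Bialgebra.counitAlgHom k H) := by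
      have h5 : (Algebra.TensorProduct.map (Bialgebra.counitAlgHom k H) (AlgHom.id k H)).comp
          (Bialgebra.comulAlgHom k H) = Algebra.TensorProduct.includeRight := by
        ext x
        exact Coalgebra.rTensor_counit_comul x
      calc _ = ((Algebra.TensorProduct.map (AlgHom.id k k) (Bialgebra.counitAlgHom k H)).comp
            (Algebra.TensorProduct.map (Bialgebra.counitAlgHom k H) (AlgHom.id k H))).comp
            (Bialgebra.comulAlgHom k H) := by rw [← Algebra.TensorProduct.map_comp]; rfl
        _ = _ := by
          rw [AlgHom.comp_assoc, h5]
          ext x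
          simpa using (TensorProduct.smul_tmul (R := k) (Coalgebra.counit (R := k) x)
            (1 : k) (1 : k)).symm
    calc _ = (Algebra.TensorProduct.map (toGm k H) (toGm k H)).comp
          (lam.comul.comp Algebra.TensorProduct.includeLeft) := rfl
      _ = ((Algebra.TensorProduct.map (toGm k H) (toGm k H)).comp
        ((Algebra.TensorProduct.map (AlgHom.id k (H ⊗[k] k[T;T⁻¹]))
          Algebra.TensorProduct.includeLeft).comp
            (Algebra.TensorProduct.assoc k k k H k[T;T⁻¹] H).symm.toAlgHom)).comp
            ((Algebra.TensorProduct.map (AlgHom.id k H) lam.hom).comp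
              (Bialgebra.comulAlgHom k H)) := by rw [lam.comul_comp_includeLeft]; rfl
      _ = (Algebra.TensorProduct.includeLeft.comp
          ((Algebra.TensorProduct.lid k k[T;T⁻¹]).toAlgHom.comp
            (Algebra.TensorProduct.map (AlgHom.id k k)
              (Algebra.TensorProduct.rid k k k[T;T⁻¹]).toAlgHom))).comp
          (((Algebra.TensorProduct.map (Bialgebra.counitAlgHom k H)
              (Algebra.TensorProduct.map (AlgHom.id k k[T;T⁻¹])
                (Bialgebra.counitAlgHom k H))).comp
            (Algebra.TensorProduct.map (AlgHom.id k H) lam.hom)).comp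
              (Bialgebra.comulAlgHom k H)) := by rw [key]; rfl
      _ = (Algebra.TensorProduct.includeLeft.comp
          ((Algebra.TensorProduct.lid k k[T;T⁻¹]).toAlgHom.comp
            (Algebra.TensorProduct.map (AlgHom.id k k)
              (Algebra.TensorProduct.rid k k k[T;T⁻¹]).toAlgHom))).comp
          ((Algebra.TensorProduct.map (AlgHom.id k k)
            (Algebra.TensorProduct.includeLeft.comp (Algebra.ofId k k[T;T⁻¹]))).comp
            (Algebra.TensorProduct.includeLeft.comp (Bialgebra.counitAlgHom k H))) := by
        rw [h3, ← h4]; rfl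
      _ = (Bialgebra.comulAlgHom k k[T;T⁻¹]).comp
          ((toGm k H).comp Algebra.TensorProduct.includeLeft) := by
        rw [h2]
        ext x
        simp [Algebra.ofId_apply, Algebra.algebraMap_eq_smul_one, Algebra.TensorProduct.one_def,
          TensorProduct.smul_tmul']
      _ = _ := rfl
  · ext x
    simp [OnePS.comul, toGm]

end Group

/-! ### Actions of `Û` and infinitesimal actions -/

section Action

variable {k H A : Type u} [Field k] [CommRing H] [HopfAlgebra k H] [CommRing A] [Algebra k A]

/-- An action of `U = Spec H` on `Spec A`. -/
abbrev UAction (k H A : Type u) [Field k] [CommRing H] [HopfAlgebra k H] [CommRing A]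
    [Algebra k A] :=
  Coaction (Bialgebra.comulAlgHom k H) (Bialgebra.counitAlgHom k H) A

/-- An action of `𝔾ₘ` on `Spec A`. -/
abbrev GmAction (k A : Type u) [Field k] [CommRing A] [Algebra k A] :=
  Coaction (Bialgebra.comulAlgHom k k[T;T⁻¹]) (Bialgebra.counitAlgHom k k[T;T⁻¹]) A

/-- An action of `Û = U ⋊_λ 𝔾ₘ` on `Spec A`. -/
abbrev UHatAction (lam : OnePS k H) (A : Type u) [CommRing A] [Algebra k A] :=
  Coaction lam.comul (counit k H) A

/-- The restriction of an action of `Û` to `U`. -/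
def uAction {lam : OnePS k H} (ρ : UHatAction lam A) : UAction k H A :=
  ρ.restrict (toU k H) (toU_comul lam) rfl

/-- The restriction of an action of `Û` to `𝔾ₘ`. -/
def gmAction {lam : OnePS k H} (ρ : UHatAction lam A) : GmAction k A :=
  ρ.restrict (toGm k H) (toGm_comul lam) counit_comp_toGm

/-- The weight space `A_w = {a | τ(a) = t ^ (-w) ⊗ a}` of an action `τ` of `𝔾ₘ`. -/
def weightSpace (τ : GmAction k A) (w : ℤ) : Submodule k A :=
  LinearMap.eqLocus τ.hom.toLinearMap (TensorProduct.mk k k[T;T⁻¹] A (LaurentPolynomial.T (-w)))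

/-- The ring of invariants `A^U`. -/
def invariants (σ : UAction k H A) : Subalgebra k A :=
  AlgHom.equalizer σ.hom Algebra.TensorProduct.includeRight

/-- The derivation of `A` by which `ξ ∈ 𝔲` acts: `a ↦ ξ.a = -(ξ ⊗ 1)(σ(a))`. -/
def lieDerivation (σ : UAction k H A) (ξ : lie k H) : Derivation k A A :=
  Derivation.mk'
    (-((TensorProduct.lid k A).toLinearMap ∘ₗ LinearMap.rTensor A ξ.toDual ∘ₗ σ.hom.toLinearMap)) (by
      have h : ∀ x y : H ⊗[k] A,
          TensorProduct.lid k A (LinearMap.rTensor A ξ.toDual (x * y)) =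
            TensorProduct.lid k A
              (LinearMap.rTensor A (Bialgebra.counitAlgHom k H).toLinearMap x) *
                TensorProduct.lid k A (LinearMap.rTensor A ξ.toDual y) +
            TensorProduct.lid k A
              (LinearMap.rTensor A (Bialgebra.counitAlgHom k H).toLinearMap y) *
                TensorProduct.lid k A (LinearMap.rTensor A ξ.toDual x) := by
        intro x y
        induction x with
        | zero => simp
        | add x₁ x₂ h₁ h₂ => simp only [add_mul, mul_add, map_add, h₁, h₂]; ring
        | tmul p a =>
          induction y with
          | zero => simp
          | add y₁ y₂ h₁ h₂ => simp only [add_mul, mul_add, map_add, h₁, h₂]; ring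
          | tmul r b =>
            simp [lie.toDual_mul, add_smul, mul_smul, mul_comm b a,
              smul_comm (ξ.toDual r), smul_comm (ξ.toDual p)]
      have hε : ∀ a : A, TensorProduct.lid k A
          (LinearMap.rTensor A (Bialgebra.counitAlgHom k H).toLinearMap (σ.hom a)) = a :=
        fun a => DFunLike.congr_fun σ.counit a
      intro a b
      have := h (σ.hom a) (σ.hom b)
      rw [hε, hε] at this
      simp only [LinearMap.neg_apply, LinearMap.comp_apply, AlgHom.toLinearMap_apply, map_mul,
        LinearEquiv.coe_coe, this, smul_eq_mul]
      ring)

variable [Algebra.FiniteType k H]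

/-- The infinitesimal action `φ : Ω_{A/k} → 𝔲* ⊗ A`,
`a db ↦ ∑ i, u_i ⊗ a (ξ_i.b)` for a basis `ξ_i` of `𝔲` with dual basis `u_i`
(the result does not depend on the basis). The factor `A` is written on the left. -/
def infinitesimalAction (σ : UAction k H A) :
    Ω[A⁄k] →ₗ[A] A ⊗[k] Module.Dual k (lie k H) :=
  ∑ i, ((LinearMap.toSpanSingleton A (A ⊗[k] Module.Dual k (lie k H))
      (1 ⊗ₜ[k] (Module.finBasis k (lie k H)).coord i)).comp
    (lieDerivation σ (Module.finBasis k (lie k H) i)).liftKaehlerDifferential)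

/-- For a linear map `q : 𝔲 → 𝔰`, the composition `𝔰* ⊗ A → 𝔲* ⊗ A → coker φ` is an
isomorphism. -/
def IsCokernelComplement (σ : UAction k H A) {s : Type v} [AddCommGroup s] [Module k s]
    (q : lie k H →ₗ[k] s) : Prop :=
  Function.Bijective
    ((LinearMap.range (infinitesimalAction σ)).mkQ ∘ₗ LinearMap.baseChange A q.dualMap)

/-- The affine CDRS condition for an action of `Û = U ⋊_λ 𝔾ₘ` on `Spec A` when `λ` has one
weight on `𝔲`, with respect to the surjective linear map `q : 𝔲 → 𝔰`: all weights of `A` are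
non-positive, and `𝔰* ⊗ A` maps isomorphically onto the cokernel of the infinitesimal action. -/
structure AffineCDRS {lam : OnePS k H} (ρ : UHatAction lam A) {s : Type v} [AddCommGroup s]
    [Module k s] (q : lie k H →ₗ[k] s) : Prop where
  grading : DirectSum.IsInternal fun w : {w : ℤ // w ≤ 0} => weightSpace (gmAction ρ) w
  surjective : Function.Surjective q
  cokernel : IsCokernelComplement (uAction ρ) q

end Action

/-! ### Geometric quotients -/

section Quotient

variable {S G X Y Y' : Scheme.{u}} (gS : G ⟶ S) (xS : X ⟶ S)

/-- `π : X ⟶ Y` is a geometric quotient for the action `σ : G ×_S X ⟶ X`. -/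
structure IsGeometricQuotient (σ : pullback gS xS ⟶ X) (π : X ⟶ Y) : Prop where
  /-- `π` is `G`-invariant. -/
  invariant : σ ≫ π = pullback.snd gS xS ≫ π
  affine : IsAffineHom π
  surjective : Surjective π
  /-- `𝒪_Y → π_* 𝒪_X` is injective. -/
  app_injective : ∀ V : Y.Opens, Function.Injective (π.app V)
  /-- The image of `𝒪_Y → π_* 𝒪_X` is the subsheaf of invariant functions. -/
  mem_range_app_iff : ∀ (V : Y.Opens) (f : Γ(X, π ⁻¹ᵁ V)),
    f ∈ Set.range (π.app V) ↔
      σ.appLE (π ⁻¹ᵁ V) ((σ ≫ π) ⁻¹ᵁ V) le_rfl f =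
        (pullback.snd gS xS).appLE (π ⁻¹ᵁ V) ((σ ≫ π) ⁻¹ᵁ V) (by rw [invariant]; rfl) f
  /-- Images of `G`-invariant closed subsets are closed. -/
  isClosed_image : ∀ W : Set X, IsClosed W → pullback.snd gS xS ⁻¹' W ⊆ σ ⁻¹' W →
    IsClosed (π '' W)
  /-- Disjoint `G`-invariant closed subsets have disjoint images. -/
  disjoint_image : ∀ W₁ W₂ : Set X, IsClosed W₁ → IsClosed W₂ →
    pullback.snd gS xS ⁻¹' W₁ ⊆ σ ⁻¹' W₁ → pullback.snd gS xS ⁻¹' W₂ ⊆ σ ⁻¹' W₂ →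
    Disjoint W₁ W₂ → Disjoint (π '' W₁) (π '' W₂)
  /-- The geometric fibres of `π` are single orbits: `G ×_S X ⟶ X ×_Y X`, `(g, x) ↦ (g x, x)`
  is surjective. -/
  orbits : Surjective (pullback.lift σ (pullback.snd gS xS) invariant :
    pullback gS xS ⟶ pullback π π)

variable {xS} in
/-- The action `σ : G ×_S X ⟶ X` induces an action on `X ×_Y Y'` if `π : X ⟶ Y` is
`G`-invariant: `g · (x, y') = (g x, y')`. -/
def baseChangeAction {σ : pullback gS xS ⟶ X} {π : X ⟶ Y}
    (h : σ ≫ π = pullback.snd gS xS ≫ π) (g : Y' ⟶ Y) :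
    pullback gS (pullback.fst π g ≫ xS) ⟶ pullback π g :=
  pullback.lift
    (pullback.lift (pullback.fst gS (pullback.fst π g ≫ xS))
      (pullback.snd gS (pullback.fst π g ≫ xS) ≫ pullback.fst π g)
      (by rw [pullback.condition, Category.assoc]) ≫ σ)
    (pullback.snd gS (pullback.fst π g ≫ xS) ≫ pullback.snd π g)
    (by rw [Category.assoc, h, pullback.lift_snd_assoc, Category.assoc, Category.assoc,
      pullback.condition])

/-- `π : X ⟶ Y` is a universal geometric quotient for the action `σ : G ×_S X ⟶ X`: every base
change `X ×_Y Y' ⟶ Y'` is a geometric quotient for the induced action. -/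
structure IsUniversalGeometricQuotient (σ : pullback gS xS ⟶ X) (π : X ⟶ Y) : Prop where
  invariant : σ ≫ π = pullback.snd gS xS ≫ π
  baseChange : ∀ {Y' : Scheme.{u}} (g : Y' ⟶ Y),
    IsGeometricQuotient gS (pullback.fst π g ≫ xS) (baseChangeAction gS invariant g)
      (pullback.snd π g)

end Quotient

section SpecAction

variable {k H A : Type u} [Field k] [CommRing H] [HopfAlgebra k H] [CommRing A] [Algebra k A]

/-- The action morphism `U × Y ⟶ Y` for `U = Spec H` and `Y = Spec A`. -/
def actionMorphism (σ : UAction k H A) :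
    pullback (Spec.map (CommRingCat.ofHom (algebraMap k H)))
      (Spec.map (CommRingCat.ofHom (algebraMap k A))) ⟶ Spec (.of A) :=
  (pullbackSpecIso k H A).hom ≫ Spec.map (CommRingCat.ofHom σ.hom.toRingHom)

/-- The morphism `Y = Spec A ⟶ Y / U = Spec (A^U)`. -/
def quotientMorphism (σ : UAction k H A) : Spec (.of A) ⟶ Spec (.of (invariants σ)) :=
  Spec.map (CommRingCat.ofHom (algebraMap (invariants σ) A))

end SpecAction

end UHat

end

/-!
Write `D_ξ` for the derivation of `A` by which `ξ ∈ 𝔲` acts, `B` for `A^U`, and `𝔱` for the kernel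
of `q : 𝔲 → 𝔰`.

*Weights.* Differentiating `t · (u · y) = λ(t)(u) · (t · y)` in `u` shows that every `D_ξ` raises
weights by `w` (`lieDerivation_mem_weightSpace`). Since `[D_ξ, D_η]` comes from an element of `𝔲`
again, it raises weights both by `w` and by `2 w`, so it vanishes (`lieDerivation_comm`). The `D_ξ`
are locally nilpotent since `U` is unipotent (`lieDerivation_nilpotent`).

*Slices.* By the cokernel condition `φ` maps `Ω_{A/k}` onto `𝔱* ⊗ A`. Since the weights of `A` are
non-positive, the constant vectors in `𝔱*`, which have weight zero, are reached by exact
differentials, so there are functions `x j` with `D_{ξ i} (x j) = δ i j` for a basis `ξ` of `𝔱`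
(`AffineCDRS.exists_lieDerivation_eq`). The condition also shows that a function killed by `𝔱` is
killed by `𝔲`, and such a function is `U`-invariant (`AffineCDRS.mem_invariants`). The latter uses
that `U` is unipotent and `k` has characteristic zero: the power maps `u ↦ u ^ m` are polynomial in
`m`, which gives a logarithm on `U`, and a function whose derivatives along `𝔲` vanish is constant
(`eq_algebraMap_counit_of_lieDerivation_eq_zero`).

*Structure.* The `D_{ξ i}` are commuting locally nilpotent derivations with common kernel `B` and
slices `x i`, so the `x i` generate `A` over `B` (`Derivation.adjoin_slice_eq_top`). The points
`exp (c ξ i)` of `U` translate `x i` by arbitrary amounts (`exists_act_eq_add`). Translating by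
independent variables shows that the `x i` are algebraically independent over `B`
(`aeval_slice_injective`), so `A` is a polynomial ring over `B`; in particular `B` is a quotient of
`A`, hence of finite type. The `dx i` form a basis of `Ω_{A/B}` which `φ` maps to vectors whose
coordinates along `𝔱*` are `δ i j`, so the factorization of `φ` is injective.

*Quotient.* Translating `1 ⊗ x i` to `x i ⊗ 1` gives a morphism `Y ×_{Y/U} Y → U` with values
dividing the first point by the second (`exists_act_includeRight_eq_includeLeft`), and `x = 0` is a
section of `Y → Y/U`. A section and a division map persist under base change, and they formally
imply all the properties of a geometric quotient (`isUniversalGeometricQuotient_of_section`).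
-/

/-! ### Locally nilpotent derivations -/

section LocallyNilpotent

variable {k A : Type*} [Field k] [CommRing A] [Algebra k A]

lemma Derivation.iterate_mul (D : Derivation k A A) (n : ℕ) (a b : A) :
    D^[n] (a * b) =
      ∑ ij ∈ Finset.HasAntidiagonal.antidiagonal n, n.choose ij.1 • (D^[ij.1] a * D^[ij.2] b) := by
  induction n with
  | zero => simp
  | succ n ih =>
    rw [Finset.sum_antidiagonal_choose_succ_nsmul (M := A) (fun i j => D^[i] a * D^[j] b) n]
    simp only [Function.iterate_succ_apply', ih, map_sum, map_nsmul, Derivation.leibniz, smul_add,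
      smul_eq_mul, Finset.sum_add_distrib, mul_comm (D^[_] b)]
    congr 1
    refine Finset.sum_congr rfl fun ij hij => ?_
    rw [n.choose_symm_of_eq_add (Finset.HasAntidiagonal.mem_antidiagonal.1 hij).symm]

lemma Derivation.iterate_add (D : Derivation k A A) (n : ℕ) (a b : A) :
    D^[n] (a + b) = D^[n] a + D^[n] b :=
  iterate_map_add (D : A →+ A) n a b

lemma Derivation.iterate_smul (D : Derivation k A A) (n : ℕ) (c : k) (a : A) :
    D^[n] (c • a) = c • D^[n] a := by
  induction n with
  | zero => rfl
  | succ n ih => rw [Function.iterate_succ_apply', ih, map_smul, Function.iterate_succ_apply']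

lemma Derivation.iterate_zero_of_le {D : Derivation k A A} {m n : ℕ} (h : m ≤ n) {a : A}
    (ha : D^[m] a = 0) : D^[n] a = 0 := by
  obtain ⟨l, rfl⟩ := Nat.exists_eq_add_of_le' h
  rw [Function.iterate_add_apply, ha, iterate_map_zero]

/-- The elements killed by a power of a derivation form a subalgebra, so local nilpotency can be
checked on generators. -/
def Derivation.nilSubalgebra (D : Derivation k A A) : Subalgebra k A where
  carrier := {a | ∃ n, D^[n] a = 0}
  mul_mem' := by
    rintro a b ⟨m, hm⟩ ⟨n, hn⟩
    refine ⟨m + n, ?_⟩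
    rw [D.iterate_mul]
    refine Finset.sum_eq_zero fun ij hij => ?_
    rw [Finset.HasAntidiagonal.mem_antidiagonal] at hij
    rcases le_total m ij.1 with h | h
    · rw [iterate_zero_of_le h hm, zero_mul, smul_zero]
    · rw [iterate_zero_of_le (show n ≤ ij.2 by omega) hn, mul_zero, smul_zero]
  add_mem' := by
    rintro a b ⟨m, hm⟩ ⟨n, hn⟩
    refine ⟨max m n, ?_⟩
    rw [D.iterate_add, iterate_zero_of_le (le_max_left m n) hm,
      iterate_zero_of_le (le_max_right m n) hn, add_zero]
  algebraMap_mem' r := ⟨1, by simp⟩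

variable {R : Type*} [CommRing R] [Algebra k R]

open Classical in
/-- For a locally nilpotent derivation `D` of `A` and an algebra homomorphism `f : A → R`, the
polynomial `∑ n, f (D ^ n a) / n! X ^ n`. -/
noncomputable def Derivation.expPoly (D : Derivation k A A) (hD : ∀ a, ∃ n, D^[n] a = 0)
    (f : A →ₐ[k] R) (a : A) : Polynomial R :=
  ∑ n ∈ Finset.range (Nat.find (hD a)),
    Polynomial.monomial n ((n.factorial : k)⁻¹ • f (D^[n] a))

lemma Derivation.coeff_expPoly (D : Derivation k A A) (hD : ∀ a, ∃ n, D^[n] a = 0)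
    (f : A →ₐ[k] R) (a : A) (n : ℕ) :
    (D.expPoly hD f a).coeff n = (n.factorial : k)⁻¹ • f (D^[n] a) := by
  classical
  simp only [expPoly, Polynomial.finsetSum_coeff, Polynomial.coeff_monomial, Finset.sum_ite_eq',
    Finset.mem_range]
  split_ifs with h
  · rfl
  · rw [iterate_zero_of_le (not_lt.mp h) (Nat.find_spec (hD a)), map_zero, smul_zero]

/-- The homomorphism `f ∘ exp (X D) : A → R[X]`, `a ↦ ∑ n, f (D ^ n a) / n! X ^ n`. -/
noncomputable def Derivation.expHom [CharZero k] (D : Derivation k A A)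
    (hD : ∀ a, ∃ n, D^[n] a = 0) (f : A →ₐ[k] R) : A →ₐ[k] Polynomial R := by
  let P := D.expPoly hD f
  have hp (a : A) (n : ℕ) : (P a).coeff n = (n.factorial : k)⁻¹ • f (D^[n] a) :=
    D.coeff_expPoly hD f a n
  have hone : P 1 = 1 := by
    ext n
    rw [hp, Polynomial.coeff_one]
    cases n with
    | zero => simp
    | succ n => simp [Function.iterate_succ_apply, iterate_map_zero]
  have hmul (a b : A) : P (a * b) = P a * P b := by
    ext n
    rw [hp, Polynomial.coeff_mul, D.iterate_mul, map_sum, Finset.smul_sum]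
    refine Finset.sum_congr rfl fun ij hij => ?_
    obtain rfl := Finset.HasAntidiagonal.mem_antidiagonal.mp hij
    rw [hp, hp, smul_mul_smul_comm, ← map_mul, map_nsmul, ← Nat.cast_smul_eq_nsmul k, smul_smul]
    congr 1
    have h1 : ((ij.1 + ij.2).factorial : k) ≠ 0 := by exact_mod_cast Nat.factorial_ne_zero _
    have h2 : (ij.1.factorial : k) ≠ 0 := by exact_mod_cast Nat.factorial_ne_zero _
    have h3 : (ij.2.factorial : k) ≠ 0 := by exact_mod_cast Nat.factorial_ne_zero _
    have h4 : (((ij.1 + ij.2).choose ij.1 : ℕ) : k) * ij.1.factorial * ij.2.factorial =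
        (ij.1 + ij.2).factorial := by
      have := Nat.choose_mul_factorial_mul_factorial (Nat.le_add_right ij.1 ij.2)
      rw [Nat.add_sub_cancel_left] at this
      exact_mod_cast this
    rw [← h4] at h1 ⊢
    field_simp
    exact div_self (left_ne_zero_of_mul (left_ne_zero_of_mul h1))
  have hadd (a b : A) : P (a + b) = P a + P b := by
    ext n
    rw [hp, Polynomial.coeff_add, hp, hp, D.iterate_add, map_add, smul_add]
  have hsmul (c : k) (a : A) : P (c • a) = c • P a := by
    ext n
    rw [hp, Polynomial.coeff_smul, hp, D.iterate_smul, AlgHom.map_smul_of_tower, smul_comm]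
  exact AlgHom.ofLinearMap ⟨⟨P, hadd⟩, hsmul⟩ hone hmul

lemma Derivation.coeff_expHom [CharZero k] (D : Derivation k A A) (hD : ∀ a, ∃ n, D^[n] a = 0)
    (f : A →ₐ[k] R) (a : A) (n : ℕ) :
    (D.expHom hD f a).coeff n = (n.factorial : k)⁻¹ • f (D^[n] a) :=
  D.coeff_expPoly hD f a n

end LocallyNilpotent

/-! ### Slices of commuting derivations -/

section Slice

variable {k A ι : Type*} [Field k] [CommRing A] [Algebra k A]

lemma Derivation.iterate_slice_pow_mul (D : Derivation k A A) {x c : A} (hx : D x = 1)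
    (hc : D c = 0) (n : ℕ) : D^[n] (x ^ n * c) = (n.factorial : k) • c := by
  induction n with
  | zero => simp
  | succ n ih =>
    have h : D (x ^ (n + 1) * c) = ((n + 1 : ℕ) : k) • (x ^ n * c) := by
      rw [Derivation.leibniz, hc, Derivation.leibniz_pow, hx, Nat.cast_smul_eq_nsmul]
      simp [mul_comm c]
      ring
    rw [Function.iterate_succ_apply, h, D.iterate_smul, ih, smul_smul, Nat.factorial_succ,
      Nat.cast_mul]

/-- If commuting locally nilpotent derivations `D i` have a slice `x`, that is, `D i (x j) = δ i j`,
then `A` is generated by the `x i` over every subalgebra containing the common kernel: an element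
killed by `D i ^ (n + 1)` becomes one killed by `D i ^ n` upon subtracting
`x i ^ n / n! * D i ^ n a`. -/
lemma Derivation.adjoin_slice_eq_top [CharZero k] [Finite ι] [DecidableEq ι]
    (D : ι → Derivation k A A)
    (hD : ∀ i a, ∃ n, (D i)^[n] a = 0) (hcomm : ∀ i j a, D i (D j a) = D j (D i a))
    (x : ι → A) (hx : ∀ i j, D i (x j) = if i = j then 1 else 0) (B : Subalgebra k A)
    (hB : ∀ a, (∀ i, D i a = 0) → a ∈ B) : Algebra.adjoin B (Set.range x) = ⊤ := by
  cases nonempty_fintype ι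
  rw [eq_top_iff]
  rintro a -
  suffices H : ∀ S : Finset ι, ∀ a, (∀ i ∉ S, D i a = 0) → a ∈ Algebra.adjoin B (Set.range x) from
    H Finset.univ a (by simp)
  clear a
  intro S
  induction S using Finset.induction_on with
  | empty =>
    intro a ha
    exact Subalgebra.algebraMap_mem _ (⟨a, hB a (by simpa using ha)⟩ : B)
  | insert i S hi ih =>
    intro a ha
    obtain ⟨n, hn⟩ := hD i a
    induction n generalizing a with
    | zero =>
      have : a = 0 := hn
      rw [this]
      exact Subalgebra.zero_mem _
    | succ n ihn =>
      have hkj (j : ι) (m : ℕ) (h : D j a = 0) : D j ((D i)^[m] a) = 0 := by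
        have := (Function.Commute.iterate_left (f := D i) (g := D j) (hcomm i j) m).eq a
        rw [← this, h, iterate_map_zero]
      set c := (D i)^[n] a with hc
      have hci : D i c = 0 := (Function.iterate_succ_apply' (D i) n a).symm.trans hn
      have hcmem : c ∈ Algebra.adjoin B (Set.range x) := ih c fun j hj => by
        by_cases hji : j = i
        · rw [hji, hci]
        · exact hkj j n (ha j (by simp [hji, hj]))
      have hxi : x i ∈ Algebra.adjoin B (Set.range x) :=
        Algebra.subset_adjoin (Set.mem_range_self i)
      have hmem : (n.factorial : k)⁻¹ • (x i ^ n * c) ∈ Algebra.adjoin B (Set.range x) := by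
        rw [← algebraMap_smul B]
        exact Subalgebra.smul_mem _ (mul_mem (pow_mem hxi n) hcmem) _
      have key := ihn (a - (n.factorial : k)⁻¹ • (x i ^ n * c)) (fun j hj => by
          have hji : j ≠ i := fun h => hj (by simp [h])
          rw [map_sub, map_smul, Derivation.leibniz, Derivation.leibniz_pow, hx, if_neg hji,
            hkj j n (ha j hj), ha j hj]
          simp) (by
          rw [iterate_map_sub, (D i).iterate_smul, (D i).iterate_slice_pow_mul (by simp [hx]) hci,
            smul_smul,
            inv_mul_cancel₀ (by exact_mod_cast Nat.factorial_ne_zero n), one_smul, sub_self])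
      simpa using add_mem key hmem

end Slice

noncomputable section

namespace UHat

/-! ### The Lie algebra acts by intertwined locally nilpotent derivations -/

section Regular

variable {k H A : Type u} [Field k] [CommRing H] [HopfAlgebra k H] [CommRing A] [Algebra k A]

lemma lieDerivation_apply (σ : UAction k H A) (ξ : lie k H) (a : A) :
    lieDerivation σ ξ a = -TensorProduct.lid k A (LinearMap.rTensor A ξ.toDual (σ.hom a)) := rfl

/-- The map `ξ ↦ ξ.a`, which is linear. -/
def lieDerivationAt (σ : UAction k H A) (a : A) : lie k H →ₗ[k] A :=
  -((TensorProduct.lid k A).toLinearMap ∘ₗ LinearMap.applyₗ (σ.hom a) ∘ₗ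
    LinearMap.rTensorHom A ∘ₗ lie.toDual)

lemma lieDerivationAt_apply (σ : UAction k H A) (a : A) (ξ : lie k H) :
    lieDerivationAt σ a ξ = lieDerivation σ ξ a := rfl

variable (k H) in
/-- The action of `U` on itself by left translations. -/
def regularAction : UAction k H H where
  hom := Bialgebra.comulAlgHom k H
  coassoc := by
    ext x
    exact Coalgebra.coassoc_apply x
  counit := by
    ext x
    have := Coalgebra.rTensor_counit_comul (R := k) x
    change TensorProduct.lid k H (LinearMap.rTensor H (Coalgebra.counit (R := k)) _) = x
    exact (congrArg (TensorProduct.lid k H) this).trans (by simp)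

/-- The action map `U × Y → Y` is equivariant for the left translations of the factor `U`. -/
lemma hom_lieDerivation (σ : UAction k H A) (ξ : lie k H) (a : A) :
    σ.hom (lieDerivation σ ξ a) =
      LinearMap.rTensor A (lieDerivation (regularAction k H) ξ).toLinearMap (σ.hom a) := by
  have h1 (t : H ⊗[k] A) : TensorProduct.lid k (H ⊗[k] A)
      (LinearMap.rTensor (H ⊗[k] A) ξ.toDual
        (Algebra.TensorProduct.map (AlgHom.id k H) σ.hom t)) =
      σ.hom (TensorProduct.lid k A (LinearMap.rTensor A ξ.toDual t)) := by
    induction t with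
    | zero => simp
    | add x y hx hy => simp only [map_add, hx, hy]
    | tmul h b => simp
  have h2 (t : (H ⊗[k] H) ⊗[k] A) : TensorProduct.lid k (H ⊗[k] A)
      (LinearMap.rTensor (H ⊗[k] A) ξ.toDual (Algebra.TensorProduct.assoc k k k H H A t)) =
      LinearMap.rTensor A ((TensorProduct.lid k H).toLinearMap ∘ₗ
        LinearMap.rTensor H ξ.toDual) t := by
    induction t with
    | zero => simp
    | add x y hx hy => simp only [map_add, hx, hy]
    | tmul h b =>
      induction h with
      | zero => simp
      | add x y hx hy => simp only [TensorProduct.add_tmul, map_add, hx, hy]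
      | tmul h h' => simp [TensorProduct.smul_tmul']
  have h3 (t : H ⊗[k] A) : LinearMap.rTensor A (lieDerivation (regularAction k H) ξ).toLinearMap t =
      -LinearMap.rTensor A ((TensorProduct.lid k H).toLinearMap ∘ₗ LinearMap.rTensor H ξ.toDual)
        (Algebra.TensorProduct.map (Bialgebra.comulAlgHom k H) (AlgHom.id k A) t) := by
    induction t with
    | zero => simp
    | add x y hx hy => simp only [map_add, hx, hy, neg_add]
    | tmul h b =>
      simp only [LinearMap.rTensor_tmul, Algebra.TensorProduct.map_tmul, ← TensorProduct.neg_tmul]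
      rfl
  have h4 := DFunLike.congr_fun σ.coassoc a
  rw [lieDerivation_apply, map_neg, ← h1, h3, ← h2]
  exact congrArg (fun t => -TensorProduct.lid k (H ⊗[k] A)
    (LinearMap.rTensor (H ⊗[k] A) ξ.toDual t)) h4.symm

lemma lid_rTensor_counit_hom (σ : UAction k H A) (a : A) :
    TensorProduct.lid k A (LinearMap.rTensor A (Bialgebra.counitAlgHom k H).toLinearMap
      (σ.hom a)) = a :=
  DFunLike.congr_fun σ.counit a

lemma Coaction.hom_injective (σ : UAction k H A) : Function.Injective σ.hom := fun a b h => by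
  rw [← lid_rTensor_counit_hom σ a, h, lid_rTensor_counit_hom]

lemma hom_lieDerivation_iterate (σ : UAction k H A) (ξ : lie k H) (n : ℕ) (a : A) :
    σ.hom ((lieDerivation σ ξ)^[n] a) =
      (LinearMap.rTensor A (lieDerivation (regularAction k H) ξ).toLinearMap)^[n] (σ.hom a) := by
  induction n with
  | zero => rfl
  | succ n ih => rw [Function.iterate_succ_apply', hom_lieDerivation, ih,
      Function.iterate_succ_apply']

lemma rTensor_iterate_tmul {V : Type*} [AddCommGroup V] [Module k V] (f : V →ₗ[k] V) (n : ℕ)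
    (v : V) (a : A) : (LinearMap.rTensor A f)^[n] (v ⊗ₜ[k] a) = f^[n] v ⊗ₜ[k] a := by
  induction n with
  | zero => rfl
  | succ n ih => rw [Function.iterate_succ_apply', ih, LinearMap.rTensor_tmul,
      Function.iterate_succ_apply']

/-- In a unitriangular matrix of functions on `U`, a left translation moves an entry by a
combination of entries further down in the same column, so `𝔲` acts nilpotently on the entries. -/
lemma lieDerivation_regular_nilpotent (hU : IsUnipotent k H) (ξ : lie k H) (h : H) :
    ∃ n, (lieDerivation (regularAction k H) ξ)^[n] h = 0 := by
  obtain ⟨n, c, hc1, hc0, hΔ, htop⟩ := hU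
  set D := lieDerivation (regularAction k H) ξ with hD
  suffices H : D.nilSubalgebra = ⊤ by
    have : h ∈ D.nilSubalgebra := H ▸ trivial
    exact this
  rw [eq_top_iff, ← htop]
  refine Algebra.adjoin_le ?_
  rintro _ ⟨⟨i, j⟩, rfl⟩
  suffices H : ∀ d : ℕ, ∀ i : Fin n, n ≤ i + d → c i j ∈ D.nilSubalgebra from H n i (by omega)
  intro d
  induction d with
  | zero => intro i hi; omega
  | succ d ih =>
    intro i hi
    have hDc : D (c i j) = -∑ l, ξ.toDual (c i l) • c l j := by
      rw [hD, lieDerivation_apply]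
      change -TensorProduct.lid k H
        (LinearMap.rTensor H ξ.toDual (Coalgebra.comul (R := k) (c i j))) = _
      simp [hΔ]
    have hmem : D (c i j) ∈ D.nilSubalgebra := by
      rw [hDc]
      refine neg_mem (sum_mem fun l _ => ?_)
      rcases lt_trichotomy l i with h | rfl | h
      · rw [hc0 i l h, map_zero, zero_smul]
        exact zero_mem _
      · rw [hc1, lie.toDual_one, zero_smul]
        exact zero_mem _
      · exact Subalgebra.smul_mem _ (ih l (by have : (i : ℕ) < l := h; omega)) _
    obtain ⟨r, hr⟩ := hmem
    exact ⟨r + 1, hr⟩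

lemma lieDerivation_nilpotent (hU : IsUnipotent k H) (σ : UAction k H A) (ξ : lie k H) (a : A) :
    ∃ n, (lieDerivation σ ξ)^[n] a = 0 := by
  have key (t : H ⊗[k] A) : ∃ n,
      (LinearMap.rTensor A (lieDerivation (regularAction k H) ξ).toLinearMap)^[n] t = 0 := by
    induction t with
    | zero => exact ⟨0, rfl⟩
    | tmul h b =>
      obtain ⟨n, hn⟩ := lieDerivation_regular_nilpotent hU ξ h
      refine ⟨n, ?_⟩
      rw [rTensor_iterate_tmul]
      exact (congrArg (· ⊗ₜ[k] b) hn).trans (TensorProduct.zero_tmul _ _)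
    | add x y hx hy =>
      obtain ⟨m, hm⟩ := hx
      obtain ⟨n, hn⟩ := hy
      refine ⟨m + n, ?_⟩
      rw [iterate_map_add, Function.iterate_add_apply _ m n y, hn, add_comm m n,
        Function.iterate_add_apply _ n m x, hm, iterate_map_zero, iterate_map_zero, add_zero]
  obtain ⟨n, hn⟩ := key (σ.hom a)
  refine ⟨n, σ.hom_injective ?_⟩
  rw [hom_lieDerivation_iterate, hn, map_zero]

end Regular

/-! ### Functions killed by the Lie algebra are constant -/

section PowerMaps

/-- A polynomial over a `k`-algebra, `k` of characteristic zero, is determined by its values at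
the natural numbers. -/
lemma polynomial_eq_of_eval_natCast {k H : Type*} [Field k] [CharZero k] [CommRing H]
    [Algebra k H] {p q : Polynomial H} (h : ∀ m : ℕ, p.eval (m : H) = q.eval (m : H)) : p = q := by
  suffices key : ∀ p : Polynomial H, (∀ m : ℕ, p.eval (m : H) = 0) → p = 0 from
    sub_eq_zero.mp (key _ fun m => by rw [Polynomial.eval_sub, h, sub_self])
  clear h p q
  intro p hp
  ext n
  rw [Polynomial.coeff_zero, ← Module.forall_dual_apply_eq_zero_iff k]
  intro f
  let q : Polynomial k := ∑ i ∈ Finset.range (p.natDegree + 1),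
    Polynomial.monomial i (f (p.coeff i))
  have hq : q = 0 := by
    refine Polynomial.eq_zero_of_infinite_isRoot q
      ((Set.infinite_range_of_injective (Nat.cast_injective (R := k))).mono ?_)
    rintro _ ⟨m, rfl⟩
    have h1 : q.eval (m : k) = f (p.eval (m : H)) := by
      rw [Polynomial.eval_finsetSum, Polynomial.eval_eq_sum_range, map_sum]
      refine Finset.sum_congr rfl fun i _ => ?_
      rw [Polynomial.eval_monomial, ← Nat.cast_pow, ← Nat.cast_pow, mul_comm, mul_comm (p.coeff i),
        ← nsmul_eq_mul, ← nsmul_eq_mul, map_nsmul]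
    rw [Set.mem_ofPred_eq, Polynomial.IsRoot.def, h1, hp, map_zero]
  have : q.coeff n = f (p.coeff n) := by
    simp only [q, Polynomial.finsetSum_coeff, Polynomial.coeff_monomial, Finset.sum_ite_eq',
      Finset.mem_range]
    split_ifs with h
    · rfl
    · rw [Polynomial.coeff_eq_zero_of_natDegree_lt (by omega), map_zero]
  rw [← this, hq, Polynomial.coeff_zero]

variable {k H : Type u} [Field k] [CommRing H] [HopfAlgebra k H]

variable (k H) in
/-- The comorphism of the power map `U → U`, `u ↦ u ^ m`. -/
def powerMap (m : ℕ) : H →ₐ[k] H := (WithConv.toConv (AlgHom.id k H) ^ m).ofConv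

lemma powerMap_zero (h : H) : powerMap k H 0 h = algebraMap k H (Coalgebra.counit h) := by
  rw [powerMap, pow_zero]
  rfl

lemma powerMap_one (h : H) : powerMap k H 1 h = h := by
  rw [powerMap, pow_one]
  rfl

lemma powerMap_add (m n : ℕ) (h : H) : powerMap k H (m + n) h =
    Algebra.TensorProduct.lift (powerMap k H m) (powerMap k H n) (fun _ _ => Commute.all _ _)
      (Coalgebra.comul h) := by
  rw [powerMap, pow_add]
  exact AlgHom.convMul_apply _ _ h

lemma unitriangular_sub_one_pow_eq_zero {R : Type*} [CommRing R] {n : ℕ}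
    {c : Matrix (Fin n) (Fin n) R}
    (hc1 : ∀ i, c i i = 1) (hc0 : ∀ i j, j < i → c i j = 0) : (c - 1) ^ n = 0 := by
  suffices H : ∀ r : ℕ, ∀ i j : Fin n, (j : ℕ) < i + r → ((c - 1) ^ r) i j = 0 by
    ext i j
    exact H n i j (by omega)
  intro r
  induction r with
  | zero =>
    intro i j h
    rw [pow_zero, Matrix.one_apply_ne]
    rintro rfl
    omega
  | succ r ih =>
    intro i j h
    rw [pow_succ', Matrix.mul_apply]
    refine Finset.sum_eq_zero fun l _ => ?_
    rcases lt_trichotomy l i with hl | rfl | hl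
    · rw [Matrix.sub_apply, hc0 i l hl, Matrix.one_apply_ne hl.ne', sub_zero, zero_mul]
    · rw [Matrix.sub_apply, hc1, Matrix.one_apply_eq, sub_self, zero_mul]
    · rw [ih l j (by have : (i : ℕ) < l := hl; omega), mul_zero]

/-- On a unipotent group in characteristic zero, the `m`-th power map is polynomial in `m`: on a
unitriangular matrix it is `c ^ m = ∑ r, (m.choose r) (c - 1) ^ r`, where `c - 1` is nilpotent. -/
lemma exists_powerMap_polynomial [CharZero k] (hU : IsUnipotent k H) (h : H) :
    ∃ p : Polynomial H, ∀ m : ℕ, p.eval (m : H) = powerMap k H m h := by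
  obtain ⟨n, c, hc1, hc0, hΔ, htop⟩ := hU
  have hh : h ∈ Algebra.adjoin k (Set.range fun p : Fin n × Fin n => c p.1 p.2) := by
    rw [htop]; trivial
  induction hh using Algebra.adjoin_induction with
  | algebraMap r => exact ⟨Polynomial.C (algebraMap k H r), fun m => by simp⟩
  | add x y _ _ hx hy =>
    obtain ⟨p, hp⟩ := hx
    obtain ⟨q, hq⟩ := hy
    exact ⟨p + q, fun m => by rw [Polynomial.eval_add, hp, hq, map_add]⟩
  | mul x y _ _ hx hy =>
    obtain ⟨p, hp⟩ := hx
    obtain ⟨q, hq⟩ := hy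
    exact ⟨p * q, fun m => by rw [Polynomial.eval_mul, hp, hq, map_mul]⟩
  | mem x hx =>
    obtain ⟨⟨i, j⟩, rfl⟩ := hx
    -- the value of `c` at the identity is unitriangular, hence invertible, and idempotent
    let e : Matrix (Fin n) (Fin n) k := c.map (Coalgebra.counit (R := k))
    have he : e = 1 := by
      have hunit : IsUnit e := by
        have h1 : (e - 1) ^ n = 0 := unitriangular_sub_one_pow_eq_zero
          (fun i => by simp [e, hc1]) (fun i j hij => by simp [e, hc0 i j hij])
        have := (show IsNilpotent (e - 1) from ⟨n, h1⟩).isUnit_one_add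
        rwa [add_sub_cancel] at this
      have hidem : e * e = e := by
        ext i j
        have h1 := congrArg (Coalgebra.counit (R := k))
          (congrArg (TensorProduct.lid k H) (Coalgebra.rTensor_counit_comul (R := k) (c i j)))
        simpa [hΔ, Matrix.mul_apply, e] using h1
      exact hunit.mul_left_cancel (by rw [hidem, mul_one])
    have hpow (m : ℕ) (i j : Fin n) : powerMap k H m (c i j) = (c ^ m) i j := by
      induction m generalizing i j with
      | zero =>
        have hε : (Coalgebra.counit (R := k) (c i j)) = (1 : Matrix (Fin n) (Fin n) k) i j := by
          rw [← he]
          rfl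
        rw [powerMap_zero, pow_zero, hε, Matrix.one_apply, Matrix.one_apply]
        split_ifs <;> simp
      | succ m ih =>
        rw [powerMap_add, hΔ, map_sum, pow_succ, Matrix.mul_apply]
        simp [ih, powerMap_one]
    refine ⟨∑ r ∈ Finset.range n, Polynomial.C ((r.factorial : k)⁻¹ • ((c - 1) ^ r) i j) *
      descPochhammer H r, fun m => ?_⟩
    have hterm (r : ℕ) : (Polynomial.C ((r.factorial : k)⁻¹ • ((c - 1) ^ r) i j) *
        descPochhammer H r).eval (m : H) = (m.choose r) • ((c - 1) ^ r) i j := by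
      rw [Polynomial.eval_mul, Polynomial.eval_C, descPochhammer_eval_eq_descFactorial,
        Nat.descFactorial_eq_factorial_mul_choose, mul_comm, ← nsmul_eq_mul,
        ← Nat.cast_smul_eq_nsmul k, smul_smul, Nat.cast_mul, mul_right_comm, mul_inv_cancel₀
          (by exact_mod_cast Nat.factorial_ne_zero r), one_mul, Nat.cast_smul_eq_nsmul]
    -- `m.choose r` vanishes for `r > m` and `(c - 1) ^ r` for `r ≥ n`, so both bounds can be used
    have hext (a b : ℕ) (hab : a ≤ b) (h0 : ∀ r, a ≤ r → (m.choose r) • ((c - 1) ^ r) i j = 0) :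
        ∑ r ∈ Finset.range a, (m.choose r) • ((c - 1) ^ r) i j =
          ∑ r ∈ Finset.range b, (m.choose r) • ((c - 1) ^ r) i j :=
      Finset.sum_subset (Finset.range_mono hab) fun r _ hr => h0 r (by simpa using hr)
    have hcm : (c ^ m) i j = ∑ r ∈ Finset.range (m + 1), (m.choose r) • ((c - 1) ^ r) i j := by
      conv_lhs => rw [← sub_add_cancel c 1, (Commute.one_right (c - 1)).add_pow]
      rw [Matrix.sum_apply]
      refine Finset.sum_congr rfl fun r _ => ?_
      rw [one_pow, mul_one, ← nsmul_eq_mul', Matrix.smul_apply]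
    rw [hpow, Polynomial.eval_finsetSum, hcm, hext (m + 1) (m + 1 + n) (by omega) (fun r hr => by
        rw [Nat.choose_eq_zero_of_lt (by omega), zero_smul]),
      ← hext n (m + 1 + n) (by omega) (fun r hr => by
        rw [pow_eq_zero_of_le hr (unitriangular_sub_one_pow_eq_zero hc1 hc0), Matrix.zero_apply,
          smul_zero])]
    exact Finset.sum_congr rfl fun r _ => hterm r

/-- An element of `V ⊗ W` is zero if all its contractions with functionals on `V` are. -/
lemma tensor_eq_zero_of_forall_dual {k V W : Type*} [Field k] [AddCommGroup V] [Module k V]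
    [AddCommGroup W] [Module k W] (t : V ⊗[k] W)
    (h : ∀ f : Module.Dual k V, TensorProduct.lid k W (LinearMap.rTensor W f t) = 0) : t = 0 := by
  let b := Module.Basis.ofVectorSpace k V
  classical
  apply (TensorProduct.equivFinsuppOfBasisLeft (N := W) b).injective
  ext i
  rw [TensorProduct.equivFinsuppOfBasisLeft_apply, h, map_zero, Finsupp.zero_apply]

/-- On a unipotent group in characteristic zero, a function killed by `𝔲` is constant. Let `P h` be
the polynomial with values `h (u ^ m)` at `m`. Its linear coefficient `E h` is an `𝒪(U)`-valued
point derivation, the logarithm, and the derivative of `P h` at `m` is `∑ E h₁ · P h₂ (m)`, which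
vanishes if `h` is killed by `𝔲`. So `h = P h (1) = P h (0)` is constant. -/
lemma eq_algebraMap_counit_of_lieDerivation_eq_zero [CharZero k] (hU : IsUnipotent k H) (h : H)
    (hh : ∀ ξ, lieDerivation (regularAction k H) ξ h = 0) :
    h = algebraMap k H (Coalgebra.counit h) := by
  choose P hP using exists_powerMap_polynomial hU
  let PL : H →ₗ[k] Polynomial H :=
    { toFun := P
      map_add' := fun a b => polynomial_eq_of_eval_natCast (k := k) fun m => by
        rw [Polynomial.eval_add, hP, hP, hP, map_add]
      map_smul' := fun c a => polynomial_eq_of_eval_natCast (k := k) fun m => by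
        rw [RingHom.id_apply, Polynomial.eval_smul, hP, hP, map_smul] }
  have hmul (a b : H) : P (a * b) = P a * P b :=
    polynomial_eq_of_eval_natCast (k := k) fun m => by
      rw [Polynomial.eval_mul, hP, hP, hP, map_mul]
  have hzero (a : H) : (P a).coeff 0 = algebraMap k H (Coalgebra.counit a) := by
    rw [Polynomial.coeff_zero_eq_eval_zero, ← powerMap_zero, ← hP, Nat.cast_zero]
  let E : H →ₗ[k] H := (Polynomial.lcoeff H 1).restrictScalars k ∘ₗ PL
  have hE (a b : H) : E (a * b) =
      Coalgebra.counit (R := k) a • E b + Coalgebra.counit (R := k) b • E a := by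
    change (P (a * b)).coeff 1 = _ • (P b).coeff 1 + _ • (P a).coeff 1
    rw [hmul, Polynomial.mul_coeff_one, hzero, hzero, Algebra.smul_def, Algebra.smul_def,
      mul_comm (algebraMap k H (Coalgebra.counit b))]
  -- the logarithm contracted with a functional is an element of `𝔲`, so it kills `h`
  have hEh : LinearMap.rTensor H E (Coalgebra.comul (R := k) h) = 0 := by
    refine tensor_eq_zero_of_forall_dual _ fun f => ?_
    let ξ : lie k H := ⟨f ∘ₗ E, fun a b => by
      simp only [LinearMap.comp_apply, hE, map_add, map_smul, smul_eq_mul]⟩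
    have := hh ξ
    rw [lieDerivation_apply, neg_eq_zero] at this
    rw [← LinearMap.comp_apply (LinearMap.rTensor H f), ← LinearMap.rTensor_comp]
    exact this
  have hder (m : ℕ) : (Polynomial.derivative (P h)).eval (m : H) = 0 := by
    let L : H ⊗[k] H →ₗ[k] Polynomial H := LinearMap.mul' k (Polynomial H) ∘ₗ
      TensorProduct.map PL ((Polynomial.CAlgHom : H →ₐ[k] Polynomial H).toLinearMap ∘ₗ
        (powerMap k H m).toLinearMap)
    have hL (t : H ⊗[k] H) (n : ℕ) : (L t).eval (n : H) = Algebra.TensorProduct.lift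
        (powerMap k H n) (powerMap k H m) (fun _ _ => Commute.all _ _) t := by
      induction t with
      | zero => simp
      | add x y hx hy => simp only [map_add, Polynomial.eval_add, hx, hy]
      | tmul x y =>
        change (P x * Polynomial.C (powerMap k H m y)).eval (n : H) = _
        rw [Polynomial.eval_mul, hP, Polynomial.eval_C, Algebra.TensorProduct.lift_tmul]
    have hL1 (t : H ⊗[k] H) : (L t).coeff 1 = LinearMap.mul' k H
        (LinearMap.lTensor H (powerMap k H m).toLinearMap (LinearMap.rTensor H E t)) := by
      induction t with
      | zero => simp
      | add x y hx hy => simp only [map_add, Polynomial.coeff_add, hx, hy]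
      | tmul x y =>
        change (P x * Polynomial.C (powerMap k H m y)).coeff 1 = (P x).coeff 1 * powerMap k H m y
        rw [Polynomial.coeff_mul_C]
    have htaylor : Polynomial.taylor (m : H) (P h) = L (Coalgebra.comul h) :=
      polynomial_eq_of_eval_natCast (k := k) fun n => by
        rw [Polynomial.taylor_eval, hL, ← powerMap_add, ← Nat.cast_add, hP]
    rw [← Polynomial.taylor_coeff_one, htaylor, hL1, hEh, map_zero, map_zero]
  have hder0 : Polynomial.derivative (P h) = 0 :=
    polynomial_eq_of_eval_natCast (k := k) fun m => by rw [hder, Polynomial.eval_zero]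
  have hconst : P h = Polynomial.C ((P h).coeff 0) := by
    ext n
    cases n with
    | zero => simp
    | succ n =>
      have := congrArg (fun p => Polynomial.coeff p n) hder0
      rw [Polynomial.coeff_C_succ]
      simp only [Polynomial.coeff_derivative, Polynomial.coeff_zero] at this
      have h1 : ((n + 1 : ℕ) : k) • (P h).coeff (n + 1) = 0 := by
        rw [Nat.cast_smul_eq_nsmul, nsmul_eq_mul', ← this]
        push_cast
        rfl
      exact (smul_eq_zero.mp h1).resolve_left (Nat.cast_ne_zero.mpr n.succ_ne_zero)
  rw [← hzero, ← Polynomial.eval_C (x := ((1 : ℕ) : H)) (a := (P h).coeff 0), ← hconst, hP,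
    powerMap_one]

end PowerMaps

/-! ### Invariants and the exponential -/

section Points

variable {k H A : Type u} [Field k] [CommRing H] [HopfAlgebra k H] [CommRing A] [Algebra k A]

/-- An element of `V ⊗ W` is zero if all its contractions with functionals on `W` are. -/
lemma tensor_eq_zero_of_forall_dual_right {k V W : Type*} [Field k] [AddCommGroup V] [Module k V]
    [AddCommGroup W] [Module k W] (t : V ⊗[k] W)
    (h : ∀ f : Module.Dual k W, TensorProduct.rid k V (LinearMap.lTensor V f t) = 0) : t = 0 := by
  let b := Module.Basis.ofVectorSpace k W
  classical
  apply (TensorProduct.equivFinsuppOfBasisRight (M := V) b).injective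
  ext i
  rw [TensorProduct.equivFinsuppOfBasisRight_apply, h, map_zero, Finsupp.zero_apply]

lemma lieDerivation_eq_zero_of_mem_invariants (σ : UAction k H A) {a : A} (ha : a ∈ invariants σ)
    (ξ : lie k H) : lieDerivation σ ξ a = 0 := by
  have h : σ.hom a = 1 ⊗ₜ[k] a := ha
  rw [lieDerivation_apply, h, LinearMap.rTensor_tmul, lie.toDual_one, TensorProduct.zero_tmul,
    map_zero, neg_zero]

/-- In characteristic zero the invariants of a unipotent group are those of its Lie algebra. -/
lemma mem_invariants_of_lieDerivation_eq_zero [CharZero k] (hU : IsUnipotent k H)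
    (σ : UAction k H A) {a : A} (ha : ∀ ξ, lieDerivation σ ξ a = 0) : a ∈ invariants σ := by
  change σ.hom a = 1 ⊗ₜ[k] a
  rw [← sub_eq_zero]
  refine tensor_eq_zero_of_forall_dual_right _ fun f => ?_
  set h := TensorProduct.rid k H (LinearMap.lTensor H f (σ.hom a)) with hh
  have h1 (ξ : lie k H) : lieDerivation (regularAction k H) ξ h = 0 := by
    have key (t : H ⊗[k] A) : lieDerivation (regularAction k H) ξ
        (TensorProduct.rid k H (LinearMap.lTensor H f t)) =
        TensorProduct.rid k H (LinearMap.lTensor H f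
          (LinearMap.rTensor A (lieDerivation (regularAction k H) ξ).toLinearMap t)) := by
      induction t with
      | zero => simp
      | add x y hx hy => simp only [map_add, hx, hy]
      | tmul x y => simp
    rw [hh, key, ← hom_lieDerivation, ha, map_zero, map_zero, map_zero]
  have h2 : Coalgebra.counit (R := k) h = f a := by
    have key (t : H ⊗[k] A) : Coalgebra.counit (R := k)
        (TensorProduct.rid k H (LinearMap.lTensor H f t)) = f (TensorProduct.lid k A
          (LinearMap.rTensor A (Bialgebra.counitAlgHom k H).toLinearMap t)) := by
      induction t with
      | zero => simp
      | add x y hx hy => simp only [map_add, hx, hy]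
      | tmul x y => simp [mul_comm]
    rw [hh, key, lid_rTensor_counit_hom]
  rw [map_sub, map_sub, ← hh, eq_algebraMap_counit_of_lieDerivation_eq_zero hU h h1, h2]
  simp [Algebra.algebraMap_eq_smul_one]

variable {R : Type*} [CommRing R] [Algebra k R]

/-- The `R`-point `g · y` of `Y = Spec A` for `R`-points `g` of `U` and `y` of `Y`. -/
def Coaction.act (σ : UAction k H A) (g : H →ₐ[k] R) (y : A →ₐ[k] R) : A →ₐ[k] R :=
  (Algebra.TensorProduct.lift g y fun _ _ => Commute.all _ _).comp σ.hom

lemma Coaction.act_apply (σ : UAction k H A) (g : H →ₐ[k] R) (y : A →ₐ[k] R) (a : A) :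
    σ.act g y a = Algebra.TensorProduct.lift g y (fun _ _ => Commute.all _ _) (σ.hom a) := rfl

lemma Coaction.act_of_mem_invariants (σ : UAction k H A) (g : H →ₐ[k] R) (y : A →ₐ[k] R) {a : A}
    (ha : a ∈ invariants σ) : σ.act g y a = y a := by
  have h : σ.hom a = 1 ⊗ₜ[k] a := ha
  rw [σ.act_apply, h, Algebra.TensorProduct.lift_tmul, map_one, one_mul]

lemma Coaction.one_act (σ : UAction k H A) (y : A →ₐ[k] R) :
    σ.act ((Algebra.ofId k R).comp (Bialgebra.counitAlgHom k H)) y = y := by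
  have key (t : H ⊗[k] A) : Algebra.TensorProduct.lift
      ((Algebra.ofId k R).comp (Bialgebra.counitAlgHom k H)) y (fun _ _ => Commute.all _ _) t =
      y (TensorProduct.lid k A
        (LinearMap.rTensor A (Bialgebra.counitAlgHom k H).toLinearMap t)) := by
    induction t with
    | zero => simp
    | add x y hx hy => simp only [map_add, hx, hy]
    | tmul x y => simp [Algebra.ofId_apply, Algebra.smul_def]
  ext a
  rw [σ.act_apply, key, lid_rTensor_counit_hom]

/-- `g · (g' · y) = (g g') · y` on `R`-points. -/
lemma Coaction.exists_act_act (σ : UAction k H A) (g g' : H →ₐ[k] R) :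
    ∃ g'' : H →ₐ[k] R, ∀ y : A →ₐ[k] R, σ.act g'' y = σ.act g (σ.act g' y) := by
  let g'' := (Algebra.TensorProduct.lift g g' fun _ _ => Commute.all _ _).comp
    (Bialgebra.comulAlgHom k H)
  refine ⟨g'', fun y => ?_⟩
  let L : H ⊗[k] (H ⊗[k] A) →ₐ[k] R := Algebra.TensorProduct.lift g
    (Algebra.TensorProduct.lift g' y fun _ _ => Commute.all _ _) fun _ _ => Commute.all _ _
  have h1 : Algebra.TensorProduct.lift g'' y (fun _ _ => Commute.all _ _) =
      L.comp ((Algebra.TensorProduct.assoc k k k H H A).toAlgHom.comp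
        (Algebra.TensorProduct.map (Bialgebra.comulAlgHom k H) (AlgHom.id k A))) := by
    have h2 (t : H ⊗[k] H) (b : A) :
        L (Algebra.TensorProduct.assoc k k k H H A (t ⊗ₜ[k] b)) =
          Algebra.TensorProduct.lift g g' (fun _ _ => Commute.all _ _) t * y b := by
      induction t with
      | zero => simp
      | add x y hx hy => simp only [TensorProduct.add_tmul, map_add, hx, hy, add_mul]
      | tmul x y => simp [L, mul_assoc]
    refine Algebra.TensorProduct.ext' fun h b => ?_
    rw [Algebra.TensorProduct.lift_tmul]
    exact (h2 _ b).symm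
  have h3 : Algebra.TensorProduct.lift g (σ.act g' y) (fun _ _ => Commute.all _ _) =
      L.comp (Algebra.TensorProduct.map (AlgHom.id k H) σ.hom) := by
    refine Algebra.TensorProduct.ext' fun h b => ?_
    simp [L, Coaction.act]
  calc σ.act g'' y = (Algebra.TensorProduct.lift g'' y fun _ _ => Commute.all _ _).comp σ.hom := rfl
    _ = L.comp ((Algebra.TensorProduct.assoc k k k H H A).toAlgHom.comp
        ((Algebra.TensorProduct.map (Bialgebra.comulAlgHom k H) (AlgHom.id k A)).comp σ.hom)) := by
      rw [h1]; rfl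
    _ = (L.comp (Algebra.TensorProduct.map (AlgHom.id k H) σ.hom)).comp σ.hom := by
      rw [σ.coassoc]; rfl
    _ = σ.act g (σ.act g' y) := by rw [← h3]; rfl

/-- The `R`-point `exp (-c ξ)` of `U` translates by `κ c` every function `a` with `ξ.a = κ`
constant; the sign is that of `ξ.a = -(ξ ⊗ 1) (σ a)`. -/
lemma exists_act_eq_add_smul [CharZero k] (hU : IsUnipotent k H) (σ : UAction k H A) (ξ : lie k H)
    (c : R) : ∃ g : H →ₐ[k] R, ∀ (y : A →ₐ[k] R) (a : A) (κ : k),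
      lieDerivation σ ξ a = algebraMap k A κ → σ.act g y a = y a + κ • c := by
  set D := lieDerivation (regularAction k H) ξ with hD
  let e : H →ₐ[k] R := (Algebra.ofId k R).comp (Bialgebra.counitAlgHom k H)
  have hnil := lieDerivation_regular_nilpotent hU ξ
  let g : H →ₐ[k] R := ((Polynomial.aeval c).restrictScalars k).comp (D.expHom hnil e)
  refine ⟨g, fun y a κ ha => ?_⟩
  have key (t : H ⊗[k] A) : ∃ N, ∀ M ≥ N,
      Algebra.TensorProduct.lift g y (fun _ _ => Commute.all _ _) t =
        ∑ n ∈ Finset.range M, (n.factorial : k)⁻¹ •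
          (c ^ n * Algebra.TensorProduct.lift e y (fun _ _ => Commute.all _ _)
            ((LinearMap.rTensor A D.toLinearMap)^[n] t)) := by
    induction t with
    | zero => exact ⟨0, fun M _ => by simp [iterate_map_zero]⟩
    | add s t hs ht =>
      obtain ⟨N, hN⟩ := hs
      obtain ⟨N', hN'⟩ := ht
      refine ⟨max N N', fun M hM => ?_⟩
      rw [map_add, hN M (le_trans (le_max_left _ _) hM), hN' M (le_trans (le_max_right _ _) hM),
        ← Finset.sum_add_distrib]
      exact Finset.sum_congr rfl fun n _ => by rw [iterate_map_add, map_add, mul_add, smul_add]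
    | tmul h b =>
      refine ⟨(D.expHom hnil e h).natDegree + 1, fun M hM => ?_⟩
      have h1 : g h = (D.expHom hnil e h).eval c := by
        rw [← Polynomial.coe_aeval_eq_eval]
        rfl
      rw [Algebra.TensorProduct.lift_tmul, h1, Polynomial.eval_eq_sum_range' (by omega : _ < M),
        Finset.sum_mul]
      refine Finset.sum_congr rfl fun n _ => ?_
      rw [rTensor_iterate_tmul, Algebra.TensorProduct.lift_tmul, Derivation.coeff_expHom,
        smul_mul_assoc, smul_mul_assoc]
      congr 1
      change e (D^[n] h) * c ^ n * y b = c ^ n * (e (D^[n] h) * y b)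
      ring
  -- for the function `a` the exponential series stops after the linear term
  obtain ⟨N, hN⟩ := key (σ.hom a)
  have h1 : LinearMap.rTensor A D.toLinearMap (σ.hom a) = algebraMap k (H ⊗[k] A) κ := by
    rw [hD, ← hom_lieDerivation, ha, AlgHom.commutes]
  have h2 : LinearMap.rTensor A D.toLinearMap (algebraMap k (H ⊗[k] A) κ) = 0 := by
    rw [Algebra.algebraMap_eq_smul_one, map_smul, Algebra.TensorProduct.one_def,
      LinearMap.rTensor_tmul]
    have : D.toLinearMap 1 = 0 := D.map_one_eq_zero
    rw [this, TensorProduct.zero_tmul, smul_zero]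
  have h0 : Algebra.TensorProduct.lift e y (fun _ _ => Commute.all _ _) (σ.hom a) = y a :=
    DFunLike.congr_fun (σ.one_act y) a
  rw [σ.act_apply, hN (N + 2) (by omega), Finset.sum_range_succ', Finset.sum_range_succ',
    Finset.sum_eq_zero]
  · simp [h1, h0, Algebra.smul_def, mul_comm c, add_comm]
  · intro n _
    rw [Function.iterate_add_apply, Function.iterate_succ_apply, Function.iterate_one, h1, h2,
      iterate_map_zero, map_zero, mul_zero, smul_zero]

/-- If `ξ i.x j = δ i j`, then the `x i` can be translated by arbitrary amounts by a point of
`U`. -/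
lemma exists_act_eq_add [CharZero k] (hU : IsUnipotent k H) (σ : UAction k H A) {ι : Type*}
    [Finite ι] [DecidableEq ι] (ξ : ι → lie k H) (x : ι → A)
    (hx : ∀ i j, lieDerivation σ (ξ i) (x j) = if i = j then 1 else 0) (c : ι → R)
    (y : A →ₐ[k] R) : ∃ g : H →ₐ[k] R, ∀ i, σ.act g y (x i) = y (x i) + c i := by
  cases nonempty_fintype ι
  suffices key : ∀ S : Finset ι, ∃ g : H →ₐ[k] R,
      ∀ i, σ.act g y (x i) = y (x i) + if i ∈ S then c i else 0 by
    obtain ⟨g, hg⟩ := key Finset.univ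
    exact ⟨g, by simpa using hg⟩
  intro S
  induction S using Finset.induction_on with
  | empty => exact ⟨_, fun i => by rw [σ.one_act]; simp⟩
  | insert j S hj ih =>
    obtain ⟨g, hg⟩ := ih
    obtain ⟨g', hg'⟩ := exists_act_eq_add_smul hU σ (ξ j) (c j)
    obtain ⟨g'', hg''⟩ := σ.exists_act_act g' g
    refine ⟨g'', fun i => ?_⟩
    rw [hg'', hg' _ (x i) (if j = i then 1 else 0) (by rw [hx]; split_ifs <;> simp), hg]
    by_cases hij : j = i
    · subst hij
      simp [hj]
    · simp [hij, Ne.symm hij]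

end Points

/-! ### Weights -/

section Weights

variable {k H A : Type u} [Field k] [CommRing H] [HopfAlgebra k H] [CommRing A] [Algebra k A]

lemma mem_weightSpace {τ : GmAction k A} {v : ℤ} {a : A} :
    a ∈ weightSpace τ v ↔ τ.hom a = LaurentPolynomial.T (-v) ⊗ₜ[k] a := Iff.rfl

/-- The projection of `A` to the weight space `A_v`. -/
def weightProj (τ : GmAction k A) (v : ℤ) : A →ₗ[k] A :=
  (TensorProduct.lid k A).toLinearMap ∘ₗ LinearMap.rTensor A
    ((Finsupp.lapply (-v) : (ℤ →₀ k) →ₗ[k] k) ∘ₗ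
      (AddMonoidAlgebra.coeffLinearEquiv k).toLinearMap) ∘ₗ τ.hom.toLinearMap

lemma weightProj_of_mem {τ : GmAction k A} {u : ℤ} {a : A} (ha : a ∈ weightSpace τ u) (v : ℤ) :
    weightProj τ v a = if u = v then a else 0 := by
  rw [mem_weightSpace] at ha
  simp [weightProj, ha, LaurentPolynomial.T_apply]

lemma eq_zero_of_mem_weightSpace_of_ne {τ : GmAction k A} {u v : ℤ} {a : A}
    (hu : a ∈ weightSpace τ u) (hv : a ∈ weightSpace τ v) (huv : u ≠ v) : a = 0 := by
  have := weightProj_of_mem hu v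
  rwa [weightProj_of_mem hv v, if_pos rfl, if_neg huv] at this

/-- If `A` is the sum of its weight spaces of non-positive weights, there are no positive
weights. -/
lemma eq_zero_of_mem_weightSpace_of_pos {τ : GmAction k A}
    (hτ : ⨆ w : {w : ℤ // w ≤ 0}, weightSpace τ w = ⊤) {v : ℤ} (hv : 0 < v) {a : A}
    (ha : a ∈ weightSpace τ v) : a = 0 := by
  have h (b : A) : weightProj τ v b = 0 := by
    have hb : b ∈ ⨆ w : {w : ℤ // w ≤ 0}, weightSpace τ w := hτ ▸ Submodule.mem_top
    induction hb using Submodule.iSup_induction' with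
    | mem i x hx => rw [weightProj_of_mem hx, if_neg (by have := i.2; omega)]
    | zero => exact map_zero _
    | add x y _ _ hx hy => rw [map_add, hx, hy, add_zero]
  rw [← h a, weightProj_of_mem ha, if_pos rfl]

variable {lam : OnePS k H}

/-- The law `a (g g' y)`, restricted to `g` in the image of `p` and `g'` in the image of `p'`:
acting by `g'` and by `g` in turn is acting by the product in `Û`. -/
lemma restrict_restrict (ρ : UHatAction lam A) {C C' : Type u} [CommRing C] [Algebra k C]
    [CommRing C'] [Algebra k C'] (p : H ⊗[k] k[T;T⁻¹] →ₐ[k] C) (p' : H ⊗[k] k[T;T⁻¹] →ₐ[k] C')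
    (a : A) :
    Algebra.TensorProduct.map (AlgHom.id k C)
        ((Algebra.TensorProduct.map p' (AlgHom.id k A)).comp ρ.hom)
        (Algebra.TensorProduct.map p (AlgHom.id k A) (ρ.hom a)) =
      Algebra.TensorProduct.assoc k k k C C' A
        (Algebra.TensorProduct.map ((Algebra.TensorProduct.map p p').comp lam.comul)
          (AlgHom.id k A) (ρ.hom a)) := by
  have h1 := DFunLike.congr_fun ρ.coassoc a
  have h2 (t : (H ⊗[k] k[T;T⁻¹]) ⊗[k] A) : Algebra.TensorProduct.map (AlgHom.id k C)
        ((Algebra.TensorProduct.map p' (AlgHom.id k A)).comp ρ.hom)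
        (Algebra.TensorProduct.map p (AlgHom.id k A) t) =
      Algebra.TensorProduct.map p (Algebra.TensorProduct.map p' (AlgHom.id k A))
        (Algebra.TensorProduct.map (AlgHom.id k _) ρ.hom t) := by
    induction t with
    | zero => simp
    | add x y hx hy => simp only [map_add, hx, hy]
    | tmul x y => simp
  have h3 (t : ((H ⊗[k] k[T;T⁻¹]) ⊗[k] (H ⊗[k] k[T;T⁻¹])) ⊗[k] A) :
      Algebra.TensorProduct.map p (Algebra.TensorProduct.map p' (AlgHom.id k A))
        (Algebra.TensorProduct.assoc k k k _ _ A t) =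
      Algebra.TensorProduct.assoc k k k C C' A
        (Algebra.TensorProduct.map (Algebra.TensorProduct.map p p') (AlgHom.id k A) t) := by
    induction t with
    | zero => simp
    | add x y hx hy => simp only [map_add, hx, hy]
    | tmul x y =>
      induction x with
      | zero => simp
      | add x y hx hy => simp only [TensorProduct.add_tmul, map_add, hx, hy]
      | tmul x y => simp
  have h4 (t : (H ⊗[k] k[T;T⁻¹]) ⊗[k] A) :
      Algebra.TensorProduct.map ((Algebra.TensorProduct.map p p').comp lam.comul)
          (AlgHom.id k A) t =
        Algebra.TensorProduct.map (Algebra.TensorProduct.map p p') (AlgHom.id k A)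
          (Algebra.TensorProduct.map lam.comul (AlgHom.id k A) t) := by
    induction t with
    | zero => simp
    | add x y hx hy => simp only [map_add, hx, hy]
    | tmul x y => simp
  rw [h2, h4, ← h3]
  exact congrArg _ h1.symm

/-- `(u, 1) (e, t) = (u, t)` in `Û`. -/
lemma map_toU_toGm_comp_comul : (Algebra.TensorProduct.map (toU k H) (toGm k H)).comp lam.comul =
    AlgHom.id k _ := by
  apply Algebra.TensorProduct.ext
  · ext h
    have h1 (t : H ⊗[k] (k[T;T⁻¹] ⊗[k] H)) :
        Algebra.TensorProduct.map (toU k H) (toGm k H)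
          (Algebra.TensorProduct.map (AlgHom.id k (H ⊗[k] k[T;T⁻¹]))
            Algebra.TensorProduct.includeLeft
            ((Algebra.TensorProduct.assoc k k k H k[T;T⁻¹] H).symm t)) =
        TensorProduct.rid k H (LinearMap.lTensor H ((Coalgebra.counit (R := k)) ∘ₗ
          (TensorProduct.lid k H).toLinearMap ∘ₗ LinearMap.rTensor H
            (Bialgebra.counitAlgHom k k[T;T⁻¹]).toLinearMap) t) ⊗ₜ[k] 1 := by
      induction t with
      | zero => simp
      | add x y hx hy => simp only [map_add, hx, hy, TensorProduct.add_tmul]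
      | tmul x y =>
        induction y with
        | zero => simp
        | add y z hy hz => simp only [TensorProduct.tmul_add, map_add, hy, hz,
            TensorProduct.add_tmul]
        | tmul y z =>
          simp [toU, toGm, TensorProduct.smul_tmul', TensorProduct.tmul_smul, mul_smul,
            smul_comm (Coalgebra.counit (R := k) z)]
    have h2 (t : H ⊗[k] H) : LinearMap.lTensor H ((Coalgebra.counit (R := k)) ∘ₗ
          (TensorProduct.lid k H).toLinearMap ∘ₗ LinearMap.rTensor H
            (Bialgebra.counitAlgHom k k[T;T⁻¹]).toLinearMap)
          (Algebra.TensorProduct.map (AlgHom.id k H) lam.hom t) =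
        LinearMap.lTensor H (Coalgebra.counit (R := k)) t := by
      induction t with
      | zero => simp
      | add x y hx hy => simp only [map_add, hx, hy]
      | tmul x y =>
        simp only [Algebra.TensorProduct.map_tmul, LinearMap.lTensor_tmul]
        exact congrArg (fun z => x ⊗ₜ[k] Coalgebra.counit (R := k) z)
          (DFunLike.congr_fun lam.counit y)
    have h3 := DFunLike.congr_fun lam.comul_comp_includeLeft h
    refine (congrArg (Algebra.TensorProduct.map (toU k H) (toGm k H)) h3).trans ?_
    refine (h1 _).trans ?_
    have h4 := Coalgebra.lTensor_counit_comul (R := k) h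
    refine (congrArg (fun z => TensorProduct.rid k H z ⊗ₜ[k] (1 : k[T;T⁻¹]))
      ((h2 _).trans h4)).trans ?_
    simp
  · ext x
    simp [OnePS.comul, toU, toGm]

/-- `(e, t) (u, 1) = (λ(t)(u), t)` in `Û`. -/
lemma map_toGm_toU_comp_comul : (Algebra.TensorProduct.map (toGm k H) (toU k H)).comp lam.comul =
    Algebra.TensorProduct.lift lam.hom Algebra.TensorProduct.includeLeft
      (fun _ _ => Commute.all _ _) := by
  apply Algebra.TensorProduct.ext
  · ext h
    have h1 (t : H ⊗[k] (k[T;T⁻¹] ⊗[k] H)) :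
        Algebra.TensorProduct.map (toGm k H) (toU k H)
          (Algebra.TensorProduct.map (AlgHom.id k (H ⊗[k] k[T;T⁻¹]))
            Algebra.TensorProduct.includeLeft
            ((Algebra.TensorProduct.assoc k k k H k[T;T⁻¹] H).symm t)) =
        TensorProduct.lid k _ (LinearMap.rTensor _ (Coalgebra.counit (R := k)) t) := by
      induction t with
      | zero => simp
      | add x y hx hy => simp only [map_add, hx, hy]
      | tmul x y =>
        induction y with
        | zero => simp
        | add y z hy hz => simp only [TensorProduct.tmul_add, map_add, hy, hz]
        | tmul y z => simp [toU, toGm, TensorProduct.smul_tmul']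
    have h2 (t : H ⊗[k] H) : TensorProduct.lid k _ (LinearMap.rTensor _ (Coalgebra.counit (R := k))
          (Algebra.TensorProduct.map (AlgHom.id k H) lam.hom t)) =
        lam.hom (TensorProduct.lid k H (LinearMap.rTensor H (Coalgebra.counit (R := k)) t)) := by
      induction t with
      | zero => simp
      | add x y hx hy => simp only [map_add, hx, hy]
      | tmul x y => simp
    have h3 := DFunLike.congr_fun lam.comul_comp_includeLeft h
    refine (congrArg (Algebra.TensorProduct.map (toGm k H) (toU k H)) h3).trans ?_
    refine (h1 _).trans ((h2 _).trans ?_)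
    have h4 := Coalgebra.rTensor_counit_comul (R := k) h
    refine (congrArg (fun z => lam.hom (TensorProduct.lid k H z)) h4).trans ?_
    simp
  · ext x
    simp [OnePS.comul, toU, toGm, Algebra.TensorProduct.one_def]

/-- The action of `λ(t)` on `𝔲` by `t ^ w` means that `𝔲` raises weights by `w`: this is
`t · (u · y) = λ(t)(u) · (t · y)` differentiated with respect to `u`. -/
lemma lieDerivation_mem_weightSpace {w : ℤ} (hlam : lam.HasSingleWeight w) (ρ : UHatAction lam A)
    (ξ : lie k H) {v : ℤ} {a : A} (ha : a ∈ weightSpace (gmAction ρ) v) :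
    lieDerivation (uAction ρ) ξ a ∈ weightSpace (gmAction ρ) (v + w) := by
  rw [mem_weightSpace] at ha ⊢
  set σ := uAction ρ
  set τ := gmAction ρ
  have hut : Algebra.TensorProduct.map (AlgHom.id k H) τ.hom (σ.hom a) =
      Algebra.TensorProduct.assoc k k k H k[T;T⁻¹] A (ρ.hom a) := by
    refine (restrict_restrict ρ (toU k H) (toGm k H) a).trans ?_
    rw [map_toU_toGm_comp_comul, Algebra.TensorProduct.map_id]
    rfl
  have htu : Algebra.TensorProduct.map (AlgHom.id k k[T;T⁻¹]) σ.hom (τ.hom a) =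
      Algebra.TensorProduct.assoc k k k k[T;T⁻¹] H A
        (Algebra.TensorProduct.map (Algebra.TensorProduct.lift lam.hom
          Algebra.TensorProduct.includeLeft (fun _ _ => Commute.all _ _)) (AlgHom.id k A)
          (ρ.hom a)) := by
    refine (restrict_restrict ρ (toGm k H) (toU k H) a).trans ?_
    rw [map_toGm_toU_comp_comul]
  -- contraction of the factor `H` with `ξ`
  let c : k[T;T⁻¹] ⊗[k] (H ⊗[k] A) →ₗ[k] k[T;T⁻¹] ⊗[k] A :=
    LinearMap.lTensor _ ((TensorProduct.lid k A).toLinearMap ∘ₗ LinearMap.rTensor A ξ.toDual)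
  have h1 (t : (H ⊗[k] k[T;T⁻¹]) ⊗[k] A) :
      c (Algebra.TensorProduct.assoc k k k k[T;T⁻¹] H A
        (Algebra.TensorProduct.map (Algebra.TensorProduct.lift lam.hom
          Algebra.TensorProduct.includeLeft (fun _ _ => Commute.all _ _)) (AlgHom.id k A) t)) =
      (LaurentPolynomial.T w ⊗ₜ[k] 1) * TensorProduct.lid k _ (LinearMap.rTensor _ ξ.toDual
        (Algebra.TensorProduct.assoc k k k H k[T;T⁻¹] A t)) := by
    have h2 (u : k[T;T⁻¹] ⊗[k] H) (κ : k[T;T⁻¹]) (b : A) :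
        c (Algebra.TensorProduct.assoc k k k k[T;T⁻¹] H A ((u * κ ⊗ₜ[k] 1) ⊗ₜ[k] b)) =
          (TensorProduct.rid k k[T;T⁻¹] (LinearMap.lTensor k[T;T⁻¹] ξ.toDual u) * κ) ⊗ₜ[k] b := by
      induction u with
      | zero => simp
      | add x y hx hy => simp only [add_mul, TensorProduct.add_tmul, map_add, hx, hy]
      | tmul x y => simp [c, TensorProduct.smul_tmul']
    induction t with
    | zero => simp
    | add x y hx hy => simp only [map_add, hx, hy, mul_add]
    | tmul x b =>
      induction x with
      | zero => simp
      | add x y hx hy => simp only [TensorProduct.add_tmul, map_add, hx, hy, mul_add]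
      | tmul h κ =>
        rw [Algebra.TensorProduct.map_tmul, Algebra.TensorProduct.lift_tmul]
        refine (h2 (lam.hom h) κ b).trans ?_
        rw [hlam ξ h]
        simp [TensorProduct.smul_tmul']
  have h3 (t : H ⊗[k] A) : TensorProduct.lid k _ (LinearMap.rTensor _ ξ.toDual
      (Algebra.TensorProduct.map (AlgHom.id k H) τ.hom t)) =
      τ.hom (TensorProduct.lid k A (LinearMap.rTensor A ξ.toDual t)) := by
    induction t with
    | zero => simp
    | add x y hx hy => simp only [map_add, hx, hy]
    | tmul x y => simp
  have h4 : LaurentPolynomial.T (-v) ⊗ₜ[k] lieDerivation σ ξ a =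
      (LaurentPolynomial.T w ⊗ₜ[k] (1 : A)) * τ.hom (lieDerivation σ ξ a) := by
    have := congrArg c htu
    rw [h1, ← hut, h3, ha] at this
    rw [lieDerivation_apply, TensorProduct.tmul_neg, map_neg]
    refine (congrArg Neg.neg ?_).trans (map_neg (LinearMap.mulLeft k _) _).symm
    rw [LinearMap.mulLeft_apply, ← this]
    simp [c]
  have h5 := congrArg ((LaurentPolynomial.T (-w) ⊗ₜ[k] (1 : A)) * ·) h4
  simp only [← mul_assoc, Algebra.TensorProduct.tmul_mul_tmul, ← LaurentPolynomial.T_add,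
    one_mul, neg_add_cancel, LaurentPolynomial.T_zero] at h5
  rw [← Algebra.TensorProduct.one_def, one_mul] at h5
  rw [← h5, add_comm v w, neg_add]

/-- If `𝔲` has a single non-zero weight `w`, then it acts on `A` by commuting derivations: the
bracket of two elements of `𝔲` is again in `𝔲`, so it raises weights by `w`, but also by `2 w`. -/
lemma lieDerivation_comm {w : ℤ} (hw : w ≠ 0) (hlam : lam.HasSingleWeight w)
    (ρ : UHatAction lam A) (hA : ⨆ v : ℤ, weightSpace (gmAction ρ) v = ⊤) (ξ η : lie k H) (a : A) :
    lieDerivation (uAction ρ) ξ (lieDerivation (uAction ρ) η a) =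
      lieDerivation (uAction ρ) η (lieDerivation (uAction ρ) ξ a) := by
  set σ := uAction ρ
  let D : Derivation k H H := ⁅lieDerivation (regularAction k H) ξ,
    lieDerivation (regularAction k H) η⁆
  let ζ : lie k H := ⟨-((Bialgebra.counitAlgHom k H).toLinearMap ∘ₗ D.toLinearMap), fun a b => by
    change -(Coalgebra.counit (R := k) (D (a * b))) = Coalgebra.counit (R := k) a *
      (-(Coalgebra.counit (R := k) (D b))) + Coalgebra.counit (R := k) b *
      (-(Coalgebra.counit (R := k) (D a)))
    rw [D.leibniz, map_add, smul_eq_mul, smul_eq_mul, Bialgebra.counit_mul, Bialgebra.counit_mul]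
    ring⟩
  have hζ (b : A) : lieDerivation σ ζ b =
      lieDerivation σ ξ (lieDerivation σ η b) - lieDerivation σ η (lieDerivation σ ξ b) := by
    have h1 (t : H ⊗[k] A) : -TensorProduct.lid k A (LinearMap.rTensor A ζ.toDual t) =
        TensorProduct.lid k A (LinearMap.rTensor A (Bialgebra.counitAlgHom k H).toLinearMap
          (LinearMap.rTensor A (lieDerivation (regularAction k H) ξ).toLinearMap
            (LinearMap.rTensor A (lieDerivation (regularAction k H) η).toLinearMap t) -
          LinearMap.rTensor A (lieDerivation (regularAction k H) η).toLinearMap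
            (LinearMap.rTensor A (lieDerivation (regularAction k H) ξ).toLinearMap t))) := by
      induction t with
      | zero => simp
      | add x y hx hy =>
        simp only [map_add, neg_add, hx, hy, map_sub]
        abel
      | tmul h b =>
        simp only [LinearMap.rTensor_tmul, ← TensorProduct.sub_tmul, TensorProduct.lid_tmul]
        rw [← neg_smul]
        congr 1
        change - -(Coalgebra.counit (R := k) (D h)) = _
        rw [neg_neg]
        rfl
    rw [lieDerivation_apply, h1, ← hom_lieDerivation, ← hom_lieDerivation, ← hom_lieDerivation,
      ← hom_lieDerivation, ← map_sub, lid_rTensor_counit_hom]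
  suffices h : lieDerivation σ ζ a = 0 by rwa [hζ, sub_eq_zero] at h
  have ha : a ∈ ⨆ v : ℤ, weightSpace (gmAction ρ) v := hA ▸ Submodule.mem_top
  induction ha using Submodule.iSup_induction' with
  | mem v x hx =>
    refine eq_zero_of_mem_weightSpace_of_ne (u := v + w) (v := v + w + w)
      (lieDerivation_mem_weightSpace hlam ρ ζ hx) ?_ (by omega)
    rw [hζ]
    exact sub_mem
      (lieDerivation_mem_weightSpace hlam ρ ξ (lieDerivation_mem_weightSpace hlam ρ η hx))
      (lieDerivation_mem_weightSpace hlam ρ η (lieDerivation_mem_weightSpace hlam ρ ξ hx))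
  | zero => exact map_zero _
  | add x y _ _ hx hy => rw [map_add, hx, hy, add_zero]

end Weights

/-! ### Slices from the cokernel condition -/

section Cokernel

/-- The evaluation `𝔲* ⊗ A → A` at a vector of `𝔲`. -/
def evalBaseChange {k V : Type*} (A : Type*) [Field k] [AddCommGroup V] [Module k V] [CommRing A]
    [Algebra k A] (x : V) : A ⊗[k] Module.Dual k V →ₗ[A] A :=
  (TensorProduct.AlgebraTensorModule.rid k A A).toLinearMap ∘ₗ
    LinearMap.baseChange A (Module.Dual.eval k V x)

@[simp]
lemma evalBaseChange_tmul {k V A : Type*} [Field k] [AddCommGroup V] [Module k V] [CommRing A]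
    [Algebra k A] (x : V) (a : A) (f : Module.Dual k V) :
    evalBaseChange A x (a ⊗ₜ[k] f) = f x • a := by
  simp [evalBaseChange]

lemma evalBaseChange_baseChange_dualMap {k V W A : Type*} [Field k] [AddCommGroup V] [Module k V]
    [AddCommGroup W] [Module k W] [CommRing A] [Algebra k A] (q : V →ₗ[k] W) (x : V)
    (z : A ⊗[k] Module.Dual k W) :
    evalBaseChange A x (LinearMap.baseChange A q.dualMap z) = evalBaseChange A (q x) z := by
  induction z with
  | zero => simp
  | add y z hy hz => simp only [map_add, hy, hz]
  | tmul a f => simp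

lemma eq_zero_of_evalBaseChange_eq_zero {k V A : Type*} [Field k] [AddCommGroup V] [Module k V]
    [Module.Finite k V] [CommRing A] [Algebra k A] (z : A ⊗[k] Module.Dual k V)
    (hz : ∀ x : V, evalBaseChange A x z = 0) : z = 0 := by
  refine tensor_eq_zero_of_forall_dual_right z fun f => ?_
  obtain ⟨x, rfl⟩ := (Module.bijective_dual_eval k V).2 f
  exact hz x

/-- `𝔰* ⊗ A → 𝔲* ⊗ A → (ker q)* ⊗ A` is exact. -/
lemma mem_range_baseChange_dualMap {k V W A : Type*} [Field k] [AddCommGroup V] [Module k V]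
    [Module.Finite k V] [AddCommGroup W] [Module k W] [CommRing A] [Algebra k A] (q : V →ₗ[k] W)
    (z : A ⊗[k] Module.Dual k V)
    (hz : ∀ x ∈ LinearMap.ker q, evalBaseChange A x z = 0) :
    z ∈ LinearMap.range (LinearMap.baseChange A q.dualMap) := by
  let r := (LinearMap.ker q).subtype.dualMap
  have hex : Function.Exact q.dualMap r := by
    intro f
    have h : f ∈ LinearMap.range q.dualMap ↔ f ∈ (LinearMap.ker q).dualAnnihilator := by
      rw [LinearMap.range_dualMap_eq_dualAnnihilator_ker]
    refine Iff.trans ?_ h.symm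
    rw [Submodule.mem_dualAnnihilator]
    exact ⟨fun hf x hx => DFunLike.congr_fun hf ⟨x, hx⟩, fun hf => LinearMap.ext fun x => hf x x.2⟩
  have hr : Function.Surjective r :=
    LinearMap.dualMap_surjective_of_injective (LinearMap.ker q).subtype_injective
  have h1 : LinearMap.lTensor A r z = 0 := by
    refine eq_zero_of_evalBaseChange_eq_zero (k := k) _ fun x => ?_
    exact (evalBaseChange_baseChange_dualMap (LinearMap.ker q).subtype x z).symm ▸ hz x x.2
  obtain ⟨y, hy⟩ := (lTensor_exact A hex hr z).mp h1
  exact ⟨y, hy⟩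

variable {k H A : Type u} [Field k] [CommRing H] [HopfAlgebra k H] [CommRing A] [Algebra k A]

lemma evalBaseChange_infinitesimalAction [Algebra.FiniteType k H] (σ : UAction k H A)
    (ξ : lie k H) (ω : Ω[A⁄k]) : evalBaseChange A ξ (infinitesimalAction σ ω) =
      (lieDerivation σ ξ).liftKaehlerDifferential ω := by
  have h : evalBaseChange A ξ ∘ₗ infinitesimalAction σ =
      (lieDerivation σ ξ).liftKaehlerDifferential := by
    refine Derivation.liftKaehlerDifferential_unique _ _ (Derivation.ext fun b => ?_)
    change evalBaseChange A ξ (infinitesimalAction σ (KaehlerDifferential.D k A b)) =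
      (lieDerivation σ ξ).liftKaehlerDifferential (KaehlerDifferential.D k A b)
    have hξ := congrArg (lieDerivationAt σ b) ((Module.finBasis k (lie k H)).sum_repr ξ)
    rw [map_sum, lieDerivationAt_apply] at hξ
    rw [Derivation.liftKaehlerDifferential_comp_D, infinitesimalAction, LinearMap.sum_apply,
      map_sum, ← hξ]
    refine Finset.sum_congr rfl fun i _ => ?_
    rw [LinearMap.comp_apply, Derivation.liftKaehlerDifferential_comp_D,
      LinearMap.toSpanSingleton_apply, map_smul, evalBaseChange_tmul, smul_comm, smul_eq_mul,
      mul_one, Module.Basis.coord_apply, map_smul, lieDerivationAt_apply]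
  exact DFunLike.congr_fun h ω

variable {lam : OnePS k H}

/-- The component of weight zero of a contraction `⟨ξ, φ(ω)⟩` is `ξ.x` for a function `x`. In
`φ(a db)` with `a`, `b` homogeneous, it is non-zero only if the weight of `b` is at least `-w`, so
`a` has weight zero and is killed by `𝔲`, and `x = a b` will do. -/
lemma exists_lieDerivation_eq_weightProj {w : ℤ} (hw : 0 < w) (hlam : lam.HasSingleWeight w)
    (ρ : UHatAction lam A)
    (hA : ⨆ v : {v : ℤ // v ≤ 0}, weightSpace (gmAction ρ) v = ⊤) (ω : Ω[A⁄k]) :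
    ∃ x : A, ∀ ξ, lieDerivation (uAction ρ) ξ x =
      weightProj (gmAction ρ) 0 ((lieDerivation (uAction ρ) ξ).liftKaehlerDifferential ω) := by
  set σ := uAction ρ
  set τ := gmAction ρ
  have hmem (a : A) : a ∈ ⨆ v : {v : ℤ // v ≤ 0}, weightSpace τ v := hA ▸ Submodule.mem_top
  suffices key : ∀ a : A, ∃ x : A, ∀ ξ, lieDerivation σ ξ x =
      weightProj τ 0 ((lieDerivation σ ξ).liftKaehlerDifferential (a • ω)) by
    simpa using key 1
  have hω : ω ∈ Submodule.span A (Set.range (KaehlerDifferential.D k A)) := by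
    rw [KaehlerDifferential.span_range_derivation]; trivial
  induction hω using Submodule.span_induction with
  | zero => exact fun a => ⟨0, fun ξ => by simp⟩
  | add ω ω' _ _ hω hω' =>
    intro a
    obtain ⟨x, hx⟩ := hω a
    obtain ⟨y, hy⟩ := hω' a
    exact ⟨x + y, fun ξ => by rw [map_add, hx, hy, smul_add, map_add, map_add]⟩
  | smul b ω _ hω =>
    intro a
    rw [smul_smul]
    exact hω _
  | mem ω hω =>
    obtain ⟨b, rfl⟩ := hω
    intro a
    simp only [map_smul, Derivation.liftKaehlerDifferential_comp_D, smul_eq_mul]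
    have ha := hmem a
    induction ha using Submodule.iSup_induction' with
    | zero => exact ⟨0, fun ξ => by simp⟩
    | add a a' _ _ ha ha' =>
      obtain ⟨x, hx⟩ := ha
      obtain ⟨y, hy⟩ := ha'
      exact ⟨x + y, fun ξ => by rw [map_add, hx, hy, add_mul, map_add]⟩
    | mem p a ha =>
      have hb := hmem b
      induction hb using Submodule.iSup_induction' with
      | zero => exact ⟨0, fun ξ => by simp⟩
      | add b b' _ _ hb hb' =>
        obtain ⟨x, hx⟩ := hb
        obtain ⟨y, hy⟩ := hb'
        exact ⟨x + y, fun ξ => by rw [map_add, hx, hy, map_add, mul_add, map_add]⟩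
      | mem r b hb =>
        have hξ (ξ : lie k H) := lieDerivation_mem_weightSpace hlam ρ ξ hb
        have hmul (ξ : lie k H) :
            a * lieDerivation σ ξ b ∈ weightSpace τ (p + (r + w)) := by
          rw [mem_weightSpace] at ha ⊢
          rw [map_mul, ha, mem_weightSpace.mp (hξ ξ), Algebra.TensorProduct.tmul_mul_tmul,
            ← LaurentPolynomial.T_add, neg_add (p : ℤ)]
        by_cases hp : (p : ℤ) + (r + w) = 0
        · rcases eq_or_lt_of_le p.2 with hp0 | hp0
          · refine ⟨a * b, fun ξ => ?_⟩
            have haξ : lieDerivation σ ξ a = 0 := eq_zero_of_mem_weightSpace_of_pos hA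
              (show 0 < (p : ℤ) + w by omega) (lieDerivation_mem_weightSpace hlam ρ ξ ha)
            rw [weightProj_of_mem (hmul ξ), if_pos hp, Derivation.leibniz, haξ, smul_zero,
              add_zero, smul_eq_mul]
          · refine ⟨0, fun ξ => ?_⟩
            rw [eq_zero_of_mem_weightSpace_of_pos hA (show 0 < (r : ℤ) + w by omega) (hξ ξ)]
            simp
        · exact ⟨0, fun ξ => by rw [weightProj_of_mem (hmul ξ), if_neg hp, map_zero]⟩

variable [Algebra.FiniteType k H] {s : Type v} [AddCommGroup s] [Module k s]
  {q : lie k H →ₗ[k] s}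

/-- Every functional on `ker q` is given by the derivatives of a function on `Y`. -/
lemma AffineCDRS.exists_lieDerivation_eq {w : ℤ} (hw : 0 < w) (hlam : lam.HasSingleWeight w)
    {ρ : UHatAction lam A} (hρ : AffineCDRS ρ q) (f : Module.Dual k (lie k H)) :
    ∃ x : A, ∀ ξ ∈ LinearMap.ker q, lieDerivation (uAction ρ) ξ x = algebraMap k A (f ξ) := by
  have hA := hρ.grading.submodule_iSup_eq_top
  set φ := infinitesimalAction (uAction ρ) with hφ
  obtain ⟨y, hy⟩ := hρ.cokernel.2 ((LinearMap.range φ).mkQ (1 ⊗ₜ[k] f))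
  rw [LinearMap.comp_apply, ← sub_eq_zero, ← map_sub, Submodule.mkQ_apply,
    Submodule.Quotient.mk_eq_zero] at hy
  obtain ⟨ω, hω⟩ := hy
  obtain ⟨x, hx⟩ := exists_lieDerivation_eq_weightProj hw hlam ρ hA ω
  have h1 : (1 : A) ∈ weightSpace (gmAction ρ) 0 := by
    rw [mem_weightSpace, map_one, neg_zero, LaurentPolynomial.T_zero]
    rfl
  -- `ω` was chosen with `φ ω` equal to `-f` on `ker q`
  refine ⟨-x, fun ξ hξ => ?_⟩
  rw [map_neg, hx, ← evalBaseChange_infinitesimalAction, ← hφ, hω, map_sub,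
    evalBaseChange_baseChange_dualMap, LinearMap.mem_ker.mp hξ, evalBaseChange_tmul, map_sub,
    map_smul, weightProj_of_mem h1, if_pos rfl, Algebra.algebraMap_eq_smul_one]
  have h0 : evalBaseChange A (0 : s) y = 0 := by
    simp [evalBaseChange]
  rw [h0, map_zero, zero_sub, neg_neg]

/-- The invariants of `U` are those of the subspace `ker q` of `𝔲`: if `a` is killed by `ker q`,
then `φ(da)` comes from `𝔰* ⊗ A`, which meets the image of `φ` in zero. -/
lemma AffineCDRS.mem_invariants [CharZero k] (hU : IsUnipotent k H) {ρ : UHatAction lam A}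
    (hρ : AffineCDRS ρ q) {a : A}
    (ha : ∀ ξ ∈ LinearMap.ker q, lieDerivation (uAction ρ) ξ a = 0) :
    a ∈ invariants (uAction ρ) := by
  set φ := infinitesimalAction (uAction ρ) with hφ
  have hφa (ξ : lie k H) : evalBaseChange A ξ (φ (KaehlerDifferential.D k A a)) =
      lieDerivation (uAction ρ) ξ a := by
    rw [hφ, evalBaseChange_infinitesimalAction, Derivation.liftKaehlerDifferential_comp_D]
  obtain ⟨z, hz⟩ := mem_range_baseChange_dualMap q (φ (KaehlerDifferential.D k A a))
    fun ξ hξ => (hφa ξ).trans (ha ξ hξ)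
  have hz0 : z = 0 := by
    refine (injective_iff_map_eq_zero _).mp hρ.cokernel.1 z ?_
    rw [LinearMap.comp_apply, hz, Submodule.mkQ_apply, Submodule.Quotient.mk_eq_zero]
    exact LinearMap.mem_range_self _ _
  refine mem_invariants_of_lieDerivation_eq_zero hU _ fun ξ => ?_
  rw [← hφa, ← hz, hz0, map_zero, map_zero]

end Cokernel

/-! ### Quotients with a section and a division map -/

section Section

variable {S G X Y Y' : Scheme.{u}} {gS : G ⟶ S} {xS : X ⟶ S}

lemma appLE_appLE_apply {X Y Z : Scheme.{u}} {f : X ⟶ Y} {g : Y ⟶ Z} {h : X ⟶ Z}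
    (hfg : f ≫ g = h) {U : Z.Opens} {V : Y.Opens} {W : X.Opens} (e₁ : V ≤ g ⁻¹ᵁ U)
    (e₂ : W ≤ f ⁻¹ᵁ V) (e₃ : W ≤ h ⁻¹ᵁ U) (a : Γ(Z, U)) :
    f.appLE V W e₂ (g.appLE U V e₁ a) = h.appLE U W e₃ a := by
  subst hfg
  rw [← CommRingCat.comp_apply, Scheme.Hom.appLE_comp_appLE]

lemma appLE_id_apply {X : Scheme.{u}} {U : X.Opens} (e : U ≤ (𝟙 X : X ⟶ X) ⁻¹ᵁ U) (a : Γ(X, U)) :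
    (𝟙 X : X ⟶ X).appLE U U e a = a := by
  have : (𝟙 X : X ⟶ X).appLE U U e = 𝟙 _ :=
    (Category.id_comp _).trans (X.presheaf.map_id _)
  rw [this]
  rfl

/-- A section `s` of `π : X ⟶ Y` and a morphism `(x, x') ↦ (d (x, x'), x')` with
`d (x, x') · x' = x` on `X ×_Y X` turn `π` into a geometric quotient. The point is that
`s (π x) = d (s (π x), x) · x`, so that invariant functions and invariant closed subsets are
pulled back along `s ∘ π`. -/
lemma isGeometricQuotient_of_section {σ : pullback gS xS ⟶ X} {π : X ⟶ Y} [IsAffineHom π]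
    (h : σ ≫ π = pullback.snd gS xS ≫ π) (s : Y ⟶ X) (hs : s ≫ π = 𝟙 Y)
    (d : pullback π π ⟶ pullback gS xS) (hd : d ≫ pullback.snd gS xS = pullback.snd π π)
    (hd' : d ≫ σ = pullback.fst π π) : IsGeometricQuotient gS xS σ π := by
  let v : X ⟶ pullback gS xS :=
    pullback.lift (π ≫ s) (𝟙 X) (by rw [Category.assoc, hs, Category.comp_id, Category.id_comp]) ≫ d
  have hv : v ≫ pullback.snd gS xS = 𝟙 X := by
    simp only [v, Category.assoc, hd, pullback.lift_snd]
  have hv' : v ≫ σ = π ≫ s := by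
    simp only [v, Category.assoc, hd', pullback.lift_fst]
  have hmem (W : Set X) (hW : pullback.snd gS xS ⁻¹' W ⊆ σ ⁻¹' W) {x : X} (hx : x ∈ W) :
      s (π x) ∈ W := by
    have h1 : v x ∈ pullback.snd gS xS ⁻¹' W := by
      rw [Set.mem_preimage, ← Scheme.Hom.comp_apply, hv]
      exact hx
    have h2 := hW h1
    rwa [Set.mem_preimage, ← Scheme.Hom.comp_apply, hv', Scheme.Hom.comp_apply] at h2
  have hπs (y : Y) : π (s y) = y := by
    rw [← Scheme.Hom.comp_apply, hs]
    rfl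
  have himage (W : Set X) (hW : pullback.snd gS xS ⁻¹' W ⊆ σ ⁻¹' W) : π '' W = s ⁻¹' W := by
    ext y
    constructor
    · rintro ⟨x, hx, rfl⟩
      exact hmem W hW hx
    · exact fun hy => ⟨s y, hy, hπs y⟩
  refine ⟨h, inferInstance, ⟨fun y => ⟨s y, hπs y⟩⟩, fun V => ?_, fun V f => ?_, ?_, ?_, ?_⟩
  · have hsV : V ≤ s ⁻¹ᵁ (π ⁻¹ᵁ V) := fun y hy => by
      change π (s y) ∈ V
      rwa [hπs]
    have hid (a : Γ(Y, V)) : s.appLE (π ⁻¹ᵁ V) V hsV (π.app V a) = a := by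
      rw [Scheme.Hom.app_eq_appLE]
      exact (appLE_appLE_apply hs le_rfl hsV le_rfl a).trans (appLE_id_apply _ a)
    exact fun a b hab => by rw [← hid a, hab, hid]
  · have hsV : V ≤ s ⁻¹ᵁ (π ⁻¹ᵁ V) := fun y hy => by
      change π (s y) ∈ V
      rwa [hπs]
    constructor
    · rintro ⟨a, rfl⟩
      rw [Scheme.Hom.app_eq_appLE]
      exact (appLE_appLE_apply rfl le_rfl _ le_rfl a).trans
        (appLE_appLE_apply h.symm le_rfl _ le_rfl a).symm
    · intro hf
      refine ⟨s.appLE (π ⁻¹ᵁ V) V hsV f, ?_⟩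
      have h1 : v ≫ σ ≫ π = π := by
        rw [← Category.assoc, hv', Category.assoc, hs, Category.comp_id]
      have hvV : π ⁻¹ᵁ V ≤ v ⁻¹ᵁ ((σ ≫ π) ⁻¹ᵁ V) := by
        rw [← Scheme.Hom.comp_preimage, h1]
      have hsπ : π ⁻¹ᵁ V ≤ (π ≫ s) ⁻¹ᵁ (π ⁻¹ᵁ V) := fun x hx => hsV hx
      have h2 := congrArg (v.appLE ((σ ≫ π) ⁻¹ᵁ V) (π ⁻¹ᵁ V) hvV) hf
      have h3 := (appLE_appLE_apply hv' _ hvV hsπ f).symm.trans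
        (h2.trans ((appLE_appLE_apply hv _ hvV le_rfl f).trans (appLE_id_apply _ f)))
      rw [Scheme.Hom.app_eq_appLE]
      exact (appLE_appLE_apply rfl hsV le_rfl hsπ f).trans h3
  · intro W hWc hW
    rw [himage W hW]
    exact hWc.preimage s.continuous
  · intro W₁ W₂ _ _ h₁ h₂ hdisj
    rw [himage W₁ h₁, himage W₂ h₂]
    exact hdisj.preimage s
  · have hsplit : d ≫ pullback.lift σ (pullback.snd gS xS) h = 𝟙 _ := by
      apply pullback.hom_ext
      · rw [Category.assoc, pullback.lift_fst, hd', Category.id_comp]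
      · rw [Category.assoc, pullback.lift_snd, hd, Category.id_comp]
    exact ⟨fun y => ⟨d y, by rw [← Scheme.Hom.comp_apply, hsplit]; rfl⟩⟩

/-- Sections and division maps are stable under base change. -/
lemma isUniversalGeometricQuotient_of_section {σ : pullback gS xS ⟶ X} {π : X ⟶ Y} [IsAffineHom π]
    (h : σ ≫ π = pullback.snd gS xS ≫ π) (s : Y ⟶ X) (hs : s ≫ π = 𝟙 Y)
    (d : pullback π π ⟶ pullback gS xS) (hd : d ≫ pullback.snd gS xS = pullback.snd π π)
    (hd' : d ≫ σ = pullback.fst π π) : IsUniversalGeometricQuotient gS xS σ π := by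
  refine ⟨h, fun {Y'} g => ?_⟩
  let p : pullback (pullback.snd π g) (pullback.snd π g) ⟶ pullback π π :=
    pullback.lift (pullback.fst _ _ ≫ pullback.fst π g) (pullback.snd _ _ ≫ pullback.fst π g) (by
      rw [Category.assoc, Category.assoc, pullback.condition, pullback.condition_assoc])
  have hp : p ≫ d ≫ pullback.snd gS xS = pullback.snd _ _ ≫ pullback.fst π g := by
    rw [hd, pullback.lift_snd]
  have hp' : p ≫ d ≫ σ = pullback.fst _ _ ≫ pullback.fst π g := by
    rw [hd', pullback.lift_fst]
  have hstable : MorphismProperty.IsStableUnderBaseChange @IsAffineHom.{u} := inferInstance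
  have : IsAffineHom (pullback.snd π g) := hstable.of_isPullback (IsPullback.of_hasPullback π g) ‹_›
  refine isGeometricQuotient_of_section (pullback.lift_snd _ _ _)
    (pullback.lift (g ≫ s) (𝟙 Y') (by rw [Category.assoc, hs, Category.comp_id, Category.id_comp]))
    (pullback.lift_snd _ _ _)
    (pullback.lift (p ≫ d ≫ pullback.fst gS xS) (pullback.snd _ _) (by
      rw [Category.assoc, Category.assoc, pullback.condition, ← Category.assoc d,
        ← Category.assoc p, hp, Category.assoc]))
    (pullback.lift_snd _ _ _) ?_
  apply pullback.hom_ext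
  · rw [baseChangeAction, Category.assoc, pullback.lift_fst, ← Category.assoc, ← hp']
    refine (congrArg (· ≫ σ) ?_).trans (Category.assoc p d σ)
    apply pullback.hom_ext
    · rw [Category.assoc, pullback.lift_fst, pullback.lift_fst, Category.assoc]
    · rw [Category.assoc, pullback.lift_snd, pullback.lift_snd_assoc, Category.assoc, hp]
  · rw [baseChangeAction, Category.assoc, pullback.lift_snd, pullback.lift_snd_assoc,
      pullback.condition]

end Section

section Affine

variable {k H A : Type u} [Field k] [CommRing H] [HopfAlgebra k H] [CommRing A] [Algebra k A]

/-- The algebraic form of the criterion: a retraction `A → A^U` and a point `g` of `U` with values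
in `A ⊗ A` over `A^U` which moves the second projection to the first one. -/
lemma isUniversalGeometricQuotient_of_retraction (σ : UAction k H A)
    (r : A →ₐ[invariants σ] invariants σ) (g : H →ₐ[k] A ⊗[invariants σ] A)
    (hg : σ.act g ((Algebra.TensorProduct.includeRight :
        A →ₐ[invariants σ] A ⊗[invariants σ] A).restrictScalars k) =
      (Algebra.TensorProduct.includeLeft : A →ₐ[k] A ⊗[invariants σ] A)) :
    IsUniversalGeometricQuotient
      (Spec.map (CommRingCat.ofHom (algebraMap k H)))
      (Spec.map (CommRingCat.ofHom (algebraMap k A))) (actionMorphism σ) (quotientMorphism σ) := by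
  let e : H ⊗[k] A →ₐ[k] A ⊗[invariants σ] A := Algebra.TensorProduct.lift g
    ((Algebra.TensorProduct.includeRight :
        A →ₐ[invariants σ] A ⊗[invariants σ] A).restrictScalars k) fun _ _ => Commute.all _ _
  unfold quotientMorphism
  refine isUniversalGeometricQuotient_of_section ?_ (Spec.map (CommRingCat.ofHom r.toRingHom)) ?_
    ((pullbackSpecIso (invariants σ) A A).hom ≫ Spec.map (CommRingCat.ofHom e.toRingHom) ≫
      (pullbackSpecIso k H A).inv) ?_ ?_
  · rw [actionMorphism, ← pullbackSpecIso_hom_snd, Category.assoc,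
      Category.assoc, ← Spec.map_comp, ← Spec.map_comp, ← CommRingCat.ofHom_comp,
      ← CommRingCat.ofHom_comp]
    congr 3
    ext b
    exact b.2
  · rw [← Spec.map_comp, ← CommRingCat.ofHom_comp, ← Spec.map_id,
      ← CommRingCat.ofHom_id]
    congr 2
    ext b
    exact congrArg _ (r.commutes b)
  · rw [Category.assoc, Category.assoc, pullbackSpecIso_inv_snd, ← Spec.map_comp,
      ← CommRingCat.ofHom_comp]
    refine Eq.trans ?_ (pullbackSpecIso_hom_snd (invariants σ) A A)
    congr 3
    ext a
    change e (1 ⊗ₜ[k] a) = _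
    simp [e]
  · rw [actionMorphism, Category.assoc, Category.assoc, Iso.inv_hom_id_assoc, ← Spec.map_comp,
      ← CommRingCat.ofHom_comp]
    refine Eq.trans ?_ (pullbackSpecIso_hom_fst (invariants σ) A A)
    congr 3
    ext a
    exact DFunLike.congr_fun hg a

end Affine

/-! ### Invariants of an action with slices -/

section SliceAction

variable {k H A : Type u} [Field k] [CharZero k] [CommRing H] [HopfAlgebra k H] [CommRing A]
  [Algebra k A] {ι : Type*} [Finite ι] [DecidableEq ι] {σ : UAction k H A} {ξ : ι → lie k H}
  {x : ι → A}

/-- A polynomial relation between slices over `A^U` is trivial: translating the slices by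
independent variables turns it into a relation between independent variables. -/
lemma aeval_slice_injective (hU : IsUnipotent k H)
    (hx : ∀ i j, lieDerivation σ (ξ i) (x j) = if i = j then 1 else 0) :
    Function.Injective
      (MvPolynomial.aeval x : MvPolynomial ι (invariants σ) →ₐ[invariants σ] A) := by
  let y : A →ₐ[k] MvPolynomial ι A := IsScalarTower.toAlgHom k A (MvPolynomial ι A)
  obtain ⟨g, hg⟩ := exists_act_eq_add hU σ ξ x hx MvPolynomial.X y
  let Ψ : MvPolynomial ι A →ₐ[A] MvPolynomial ι A :=
    MvPolynomial.aeval fun i => MvPolynomial.X i - MvPolynomial.C (x i)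
  have key (P : MvPolynomial ι (invariants σ)) : Ψ (σ.act g y (MvPolynomial.aeval x P)) =
      MvPolynomial.map (algebraMap (invariants σ) A) P := by
    induction P using MvPolynomial.induction_on with
    | C b =>
      rw [MvPolynomial.aeval_C, MvPolynomial.map_C]
      exact (congrArg Ψ (σ.act_of_mem_invariants g y b.2)).trans (Ψ.commutes _)
    | add P Q hP hQ => simp only [map_add, hP, hQ]
    | mul_X P i hP =>
      simp only [map_mul, hP, MvPolynomial.aeval_X, hg, map_add, MvPolynomial.map_X]
      congr 1
      change Ψ (algebraMap A (MvPolynomial ι A) (x i)) + Ψ (MvPolynomial.X i) = _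
      rw [Ψ.commutes, MvPolynomial.aeval_X]
      exact add_sub_cancel _ _
  intro P Q hPQ
  refine MvPolynomial.map_injective (algebraMap (invariants σ) A) Subtype.val_injective ?_
  rw [← key, hPQ, key]

/-- A ring with commuting slices is a polynomial ring over the invariants. -/
def sliceEquiv (hU : IsUnipotent k H)
    (hx : ∀ i j, lieDerivation σ (ξ i) (x j) = if i = j then 1 else 0)
    (htop : Algebra.adjoin (invariants σ) (Set.range x) = ⊤) :
    A ≃ₐ[invariants σ] MvPolynomial ι (invariants σ) :=
  (AlgEquiv.ofBijective (MvPolynomial.aeval x) ⟨aeval_slice_injective hU hx, by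
    rw [← AlgHom.range_eq_top, ← Algebra.adjoin_range_eq_range_aeval, htop]⟩).symm

/-- With slices `x` generating `A` over `A^U`, the point of `U` translating the `x i` by
`x i ⊗ 1 - 1 ⊗ x i` moves the second projection of `Y ×_{Y/U} Y` to the first one. -/
lemma exists_act_includeRight_eq_includeLeft (hU : IsUnipotent k H)
    (hx : ∀ i j, lieDerivation σ (ξ i) (x j) = if i = j then 1 else 0)
    (htop : Algebra.adjoin (invariants σ) (Set.range x) = ⊤) :
    ∃ g : H →ₐ[k] A ⊗[invariants σ] A,
      σ.act g ((Algebra.TensorProduct.includeRight :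
          A →ₐ[invariants σ] A ⊗[invariants σ] A).restrictScalars k) =
        (Algebra.TensorProduct.includeLeft : A →ₐ[k] A ⊗[invariants σ] A) := by
  obtain ⟨g, hg⟩ := exists_act_eq_add hU σ ξ x hx
    (fun i => x i ⊗ₜ[invariants σ] (1 : A) - (1 : A) ⊗ₜ[invariants σ] x i)
    ((Algebra.TensorProduct.includeRight :
      A →ₐ[invariants σ] A ⊗[invariants σ] A).restrictScalars k)
  refine ⟨g, AlgHom.ext fun a => ?_⟩
  have ha : a ∈ Algebra.adjoin (invariants σ) (Set.range x) := htop ▸ Algebra.mem_top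
  induction ha using Algebra.adjoin_induction with
  | mem a ha =>
    obtain ⟨i, rfl⟩ := ha
    rw [hg]
    exact add_sub_cancel _ _
  | algebraMap b =>
    refine (σ.act_of_mem_invariants _ _ b.2).trans ?_
    exact ((Algebra.TensorProduct.includeRight :
      A →ₐ[invariants σ] A ⊗[invariants σ] A).commutes b)
  | add a b _ _ ha hb => rw [map_add, map_add, ha, hb]
  | mul a b _ _ ha hb => rw [map_mul, map_mul, ha, hb]

end SliceAction

/-! ### The factorization of the infinitesimal action -/

section Kaehler

variable {k H A : Type u} [Field k] [CommRing H] [HopfAlgebra k H] [CommRing A] [Algebra k A]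

/-- The derivations by which `𝔲` acts are linear over the invariants. -/
def lieDerivationInvariants (σ : UAction k H A) (ξ : lie k H) : Derivation (invariants σ) A A where
  toFun := lieDerivation σ ξ
  map_add' := map_add _
  map_smul' b a := by
    have : lieDerivation σ ξ (b : A) = 0 := lieDerivation_eq_zero_of_mem_invariants σ b.2 ξ
    rw [Algebra.smul_def, Derivation.leibniz]
    change (b : A) • _ + a • lieDerivation σ ξ (b : A) = _
    rw [this, smul_zero, add_zero]
    rfl
  map_one_eq_zero' := Derivation.map_one_eq_zero _
  leibniz' := Derivation.leibniz _

/-- The infinitesimal action factors through the differentials relative to the invariants. -/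
lemma exists_comp_map_eq_infinitesimalAction [Algebra.FiniteType k H] (σ : UAction k H A) :
    ∃ ψ : Ω[A⁄invariants σ] →ₗ[A] A ⊗[k] Module.Dual k (lie k H),
      ψ ∘ₗ KaehlerDifferential.map k (invariants σ) A A = infinitesimalAction σ := by
  refine ⟨∑ i, (LinearMap.toSpanSingleton A (A ⊗[k] Module.Dual k (lie k H))
      (1 ⊗ₜ[k] (Module.finBasis k (lie k H)).coord i)).comp
    (lieDerivationInvariants σ (Module.finBasis k (lie k H) i)).liftKaehlerDifferential, ?_⟩
  refine Derivation.liftKaehlerDifferential_unique _ _ (Derivation.ext fun b => ?_)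
  change (∑ i, (LinearMap.toSpanSingleton A (A ⊗[k] Module.Dual k (lie k H))
      (1 ⊗ₜ[k] (Module.finBasis k (lie k H)).coord i)).comp
    (lieDerivationInvariants σ (Module.finBasis k (lie k H) i)).liftKaehlerDifferential)
      (KaehlerDifferential.map k (invariants σ) A A (KaehlerDifferential.D k A b)) =
    infinitesimalAction σ (KaehlerDifferential.D k A b)
  rw [KaehlerDifferential.map_D, infinitesimalAction, LinearMap.sum_apply, LinearMap.sum_apply]
  refine Finset.sum_congr rfl fun i _ => ?_
  rw [LinearMap.comp_apply, LinearMap.comp_apply, Derivation.liftKaehlerDifferential_comp_D,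
    Derivation.liftKaehlerDifferential_comp_D]
  rfl

lemma span_range_D_of_adjoin_eq_top {R S ι : Type*} [CommRing R] [CommRing S] [Algebra R S]
    {x : ι → S} (htop : Algebra.adjoin R (Set.range x) = ⊤) :
    Submodule.span S (Set.range fun i => KaehlerDifferential.D R S (x i)) = ⊤ := by
  rw [eq_top_iff, ← KaehlerDifferential.span_range_derivation, Submodule.span_le]
  rintro _ ⟨a, rfl⟩
  have ha : a ∈ Algebra.adjoin R (Set.range x) := htop ▸ Algebra.mem_top
  rw [SetLike.mem_coe]
  induction ha using Algebra.adjoin_induction with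
  | mem a ha =>
    obtain ⟨i, rfl⟩ := ha
    exact Submodule.subset_span ⟨i, rfl⟩
  | algebraMap r => rw [Derivation.map_algebraMap]; exact zero_mem _
  | add a b _ _ ha hb => rw [map_add]; exact add_mem ha hb
  | mul a b _ _ ha hb =>
    rw [Derivation.leibniz]
    exact add_mem (Submodule.smul_mem _ _ hb) (Submodule.smul_mem _ _ ha)

/-- The differentials of the slices span `Ω_{A/A^U}`, and `φ` maps them to vectors with coordinates
`δ i j`, so the factorization of `φ` is injective. -/
lemma injective_of_comp_map_eq_infinitesimalAction [Algebra.FiniteType k H] {ι : Type*} [Finite ι]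
    [DecidableEq ι] {σ : UAction k H A} {ξ : ι → lie k H} {x : ι → A}
    (hx : ∀ i j, lieDerivation σ (ξ i) (x j) = if i = j then 1 else 0)
    (htop : Algebra.adjoin (invariants σ) (Set.range x) = ⊤)
    {ψ : Ω[A⁄invariants σ] →ₗ[A] A ⊗[k] Module.Dual k (lie k H)}
    (hψ : ψ ∘ₗ KaehlerDifferential.map k (invariants σ) A A = infinitesimalAction σ) :
    Function.Injective ψ := by
  cases nonempty_fintype ι
  refine (injective_iff_map_eq_zero ψ).mpr fun ω hω => ?_
  have hmem : ω ∈ Submodule.span A (Set.range fun i =>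
      KaehlerDifferential.D (invariants σ) A (x i)) := by
    rw [span_range_D_of_adjoin_eq_top htop]; trivial
  obtain ⟨a, rfl⟩ := (Submodule.mem_span_range_iff_exists_fun A).mp hmem
  refine Finset.sum_eq_zero fun i _ => ?_
  have h1 (j : ι) : evalBaseChange A (ξ i) (ψ (KaehlerDifferential.D (invariants σ) A (x j))) =
      if i = j then 1 else 0 := by
    have h2 := DFunLike.congr_fun hψ (KaehlerDifferential.D k A (x j))
    rw [LinearMap.comp_apply, KaehlerDifferential.map_D] at h2
    rw [← hx, ← Derivation.liftKaehlerDifferential_comp_D (lieDerivation σ (ξ i)),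
      ← evalBaseChange_infinitesimalAction, ← h2]
    rfl
  have h2 := congrArg (evalBaseChange A (ξ i)) hω
  simp only [map_sum, map_smul, h1, smul_eq_mul, mul_ite, mul_one, mul_zero, map_zero,
    Finset.sum_ite_eq, Finset.mem_univ, if_true] at h2
  rw [h2, zero_smul]

end Kaehler

end UHat

end

theorem mainTheorem8 {k H A : Type u} [Field k] [IsAlgClosed k] [CharZero k]
    [CommRing H] [HopfAlgebra k H] [Algebra.FiniteType k H] (hU : UHat.IsUnipotent k H)
    [CommRing A] [Algebra k A] [Algebra.FiniteType k A]
    (lam : UHat.OnePS k H) (w : ℤ) (hw : 0 < w) (hlam : lam.HasSingleWeight w)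
    (ρ : UHat.UHatAction lam A)
    {s : Type v} [AddCommGroup s] [Module k s] (q : UHat.lie k H →ₗ[k] s)
    (hρ : UHat.AffineCDRS ρ q) :
    Algebra.FiniteType k (UHat.invariants (UHat.uAction ρ)) ∧
    UHat.IsUniversalGeometricQuotient
      (Spec.map (CommRingCat.ofHom (algebraMap k H)))
      (Spec.map (CommRingCat.ofHom (algebraMap k A)))
      (UHat.actionMorphism (UHat.uAction ρ))
      (UHat.quotientMorphism (UHat.uAction ρ)) ∧
    (∃ m : ℕ, (m : ℤ) = (Module.finrank k (UHat.lie k H) : ℤ) - (Module.finrank k s : ℤ) ∧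
      Nonempty (A ≃ₐ[UHat.invariants (UHat.uAction ρ)]
        MvPolynomial (Fin m) (UHat.invariants (UHat.uAction ρ)))) ∧
    ∃ ψ : Ω[A⁄UHat.invariants (UHat.uAction ρ)] →ₗ[A] A ⊗[k] Module.Dual k (UHat.lie k H),
      ψ ∘ₗ KaehlerDifferential.map k (UHat.invariants (UHat.uAction ρ)) A A =
          UHat.infinitesimalAction (UHat.uAction ρ) ∧
        Function.Injective ψ := by
  set σ := UHat.uAction ρ
  let b := Module.finBasis k (LinearMap.ker q)
  let ξ (i : Fin (Module.finrank k (LinearMap.ker q))) : UHat.lie k H := b i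
  have hf (j : Fin (Module.finrank k (LinearMap.ker q))) :
      ∃ x : A, ∀ i, UHat.lieDerivation σ (ξ i) x = if i = j then 1 else 0 := by
    obtain ⟨f, hf⟩ := (b.coord j).exists_extend
    obtain ⟨x, hx⟩ := hρ.exists_lieDerivation_eq hw hlam f
    refine ⟨x, fun i => ?_⟩
    have h1 : f (ξ i) = if i = j then 1 else 0 := by
      have := DFunLike.congr_fun hf (b i)
      rw [Module.Basis.coord_apply, Module.Basis.repr_self, Finsupp.single_apply] at this
      exact this
    rw [hx (ξ i) (b i).2, h1]
    split_ifs <;> simp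
  choose x hx' using hf
  have hx (i j) : UHat.lieDerivation σ (ξ i) (x j) = if i = j then 1 else 0 := hx' j i
  have hA : ⨆ v : ℤ, UHat.weightSpace (UHat.gmAction ρ) v = ⊤ := by
    rw [eq_top_iff, ← hρ.grading.submodule_iSup_eq_top]
    exact iSup_le fun v => le_iSup (fun v : ℤ => UHat.weightSpace (UHat.gmAction ρ) v) v
  have hinv (a : A) (ha : ∀ i, UHat.lieDerivation σ (ξ i) a = 0) : a ∈ UHat.invariants σ := by
    refine hρ.mem_invariants hU fun η hη => ?_
    have hF : UHat.lieDerivationAt σ a ∘ₗ (LinearMap.ker q).subtype = 0 := by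
      refine b.ext fun i => ?_
      rw [LinearMap.comp_apply, UHat.lieDerivationAt_apply, LinearMap.zero_apply]
      exact ha i
    have h1 := DFunLike.congr_fun hF ⟨η, hη⟩
    rwa [LinearMap.comp_apply, UHat.lieDerivationAt_apply] at h1
  have htop : Algebra.adjoin (UHat.invariants σ) (Set.range x) = ⊤ :=
    Derivation.adjoin_slice_eq_top (fun i => UHat.lieDerivation σ (ξ i))
      (fun i a => UHat.lieDerivation_nilpotent hU σ (ξ i) a)
      (fun i j a => UHat.lieDerivation_comm hw.ne' hlam ρ hA (ξ i) (ξ j) a) x hx _ hinv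
  let e := UHat.sliceEquiv hU hx htop
  let r : A →ₐ[UHat.invariants σ] UHat.invariants σ := (MvPolynomial.aeval 0).comp e.toAlgHom
  obtain ⟨g, hg⟩ := UHat.exists_act_includeRight_eq_includeLeft hU hx htop
  obtain ⟨ψ, hψ⟩ := UHat.exists_comp_map_eq_infinitesimalAction σ
  refine ⟨?_, UHat.isUniversalGeometricQuotient_of_retraction σ r g hg, ⟨_, ?_, ⟨e⟩⟩, ψ, hψ,
    UHat.injective_of_comp_map_eq_infinitesimalAction hx htop hψ⟩
  · exact Algebra.FiniteType.of_surjective (r.restrictScalars k)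
      fun c => ⟨algebraMap _ A c, r.commutes c⟩
  · have h1 := q.finrank_range_add_finrank_ker
    rw [LinearMap.range_eq_top.mpr hρ.surjective, finrank_top] at h1
    omega
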